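/- Let $S^3$ be the three-sphere with its round metric of sectional curvature $\tfrac14$ and its standard orientation, let $\Gamma_0\subset \mathrm{SO}(4)$ be a finite subgroup acting freely on $S^3$, and let $\Sigma=S^3/\Gamma_0$ be the corresponding spherical space form with the induced metric and orientation. Let $\mathrm{Iso}(\Sigma)$ denote the group of orientation-preserving isometries of $\Sigma$ and $\mathcal I(\Sigma)$ the set of its conjugacy classes. A manifold of type $S^1\times S^3$ is a connected, oriented and time-oriented Riemannian four-manifold $M$ that is locally isometric to the Riemannian product $\mathbb R\times S^3$. Here a time orientation is a smooth unit vector field $T$ on $M$ that local isometries from open subsets of $M$ to $\mathbb R\times S^3$ take locally to $\pm\partial_t$, where $t$ is the coordinate of $\mathbb R$. Two such manifolds are isomorphic if there is an orientation-preserving diffeomorphism between them that pulls back the metric of one to the metric of the other and matches the vector fields $T$. For $\lambda>0$ and $\psi\in\mathrm{Iso}(\Sigma)$, the infinite cyclic group $\langle(\lambda,\psi)\rangle$ generated by $(t,s)\mapsto(t+\lambda,\psi(s))$ acts freely and properly discontinuously on $\mathbb R\times\Sigma$, and the quotient $(\mathbb R\times\Sigma)/\langle(\lambda,\psi)\rangle$,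 with the metric, the orientation and the vector field induced by the product metric, the product orientation and $\partial_t$, is a manifold of type $S^1\times S^3$. A manifold of type $S^1\times S^3$ is of class $\Sigma$ if it is isomorphic to such a quotient for some $\lambda>0$ and $\psi\in\mathrm{Iso}(\Sigma)$. Let $\mathfrak M(\Sigma)$ be the set of isomorphism classes of manifolds of type $S^1\times S^3$ and of class $\Sigma$. Then the assignment $$\mathbb R_{+}\times\mathcal I(\Sigma)\longrightarrow\mathfrak M(\Sigma),\qquad (\lambda,[\psi])\longmapsto\big[(\mathbb R\times\Sigma)/\langle(\lambda,\psi)\rangle\big],$$ where $\mathbb R_{+}=(0,\infty)$, is well defined and is a bijection. -/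

import Mathlib

open scoped Manifold ContDiff

noncomputable section

/-! ### Tensor data of an oriented Riemannian manifold and its isometries -/

section OrientedMetric

variable {E : Type} [NormedAddCommGroup E] [NormedSpace ℝ E]
  {H : Type} [TopologicalSpace H]

/-- The tensors of an oriented Riemannian `n`-manifold: a bilinear form and an `n`-form on each
tangent space. On the objects used below these are the metric and the Riemannian volume form of the
orientation, so that recording `vol` is the same as recording the orientation. (Smoothness, symmetry,
positivity and normalisation hold for the concrete model `S³`, hence for everything that is locally
isomorphic to a manifold built from it.) -/
structure OrientedMetric (n : ℕ) (I : ModelWithCorners ℝ E H)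
    (M : Type) [TopologicalSpace M] [ChartedSpace H M] where
  metric : ∀ x : M, TangentSpace I x →ₗ[ℝ] TangentSpace I x →ₗ[ℝ] ℝ
  vol : ∀ x : M, TangentSpace I x [⋀^Fin n]→ₗ[ℝ] ℝ

variable {n : ℕ} {I : ModelWithCorners ℝ E H}
  {M N P : Type} [TopologicalSpace M] [ChartedSpace H M] [TopologicalSpace N] [ChartedSpace H N]
  [TopologicalSpace P] [ChartedSpace H P]

/-- The differential of `F` at `x` pulls the metric and the volume form of `N` back to those of `M`:
it is an orientation-preserving linear isometry. -/
def OrientedMetric.PreservedAt (a : OrientedMetric n I M) (b : OrientedMetric n I N)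
    (F : M → N) (x : M) : Prop :=
  (∀ v w : TangentSpace I x,
    b.metric (F x) (mfderiv I I F x v) (mfderiv I I F x w) = a.metric x v w) ∧
  ∀ v : Fin n → TangentSpace I x, b.vol (F x) (fun i => mfderiv I I F x (v i)) = a.vol x v

theorem OrientedMetric.preservedAt_id (a : OrientedMetric n I M) (x : M) :
    a.PreservedAt a id x := by
  constructor
  · intro v w; rw [mfderiv_id]; rfl
  · intro v; rw [mfderiv_id]; rfl

theorem OrientedMetric.PreservedAt.comp {a : OrientedMetric n I M} {b : OrientedMetric n I N}
    {c : OrientedMetric n I P} {F : M → N} {G : N → P} {x : M}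
    (hG : b.PreservedAt c G (F x)) (hF : a.PreservedAt b F x)
    (dG : MDifferentiableAt I I G (F x)) (dF : MDifferentiableAt I I F x) :
    a.PreservedAt c (G ∘ F) x := by
  have h := mfderiv_comp x dG dF
  constructor
  · intro v w
    rw [h]
    exact (hG.1 _ _).trans (hF.1 v w)
  · intro v
    rw [h]
    exact (hG.2 _).trans (hF.2 v)

theorem OrientedMetric.PreservedAt.of_inverse {a : OrientedMetric n I M} {b : OrientedMetric n I N}
    {F : M → N} {G : N → M} {y : N} (hF : a.PreservedAt b F (G y))
    (hFG : F ∘ G = id) (dF : MDifferentiableAt I I F (G y)) (dG : MDifferentiableAt I I G y) :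
    b.PreservedAt a G y := by
  have h := mfderiv_comp y dF dG
  have hy : F (G y) = y := congrFun hFG y
  have key : ∀ v : TangentSpace I y, mfderiv I I F (G y) (mfderiv I I G y v) = v := by
    intro v
    have h2 : mfderiv I I (F ∘ G) y v = mfderiv I I F (G y) (mfderiv I I G y v) := by rw [h]; rfl
    rw [← h2, hFG, mfderiv_id]; rfl
  constructor
  · intro v w
    have := hF.1 (mfderiv I I G y v) (mfderiv I I G y w)
    rw [← this]
    simp only [key]
    rw [hy]
  · intro v
    have := hF.2 (fun i => mfderiv I I G y (v i))
    rw [← this]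
    simp only [key]
    rw [hy]

variable (I) in
/-- The group of orientation-preserving isometries of an oriented Riemannian manifold: smooth
bijections with smooth inverse that preserve the metric and the orientation. -/
def OrientedMetric.isoGroup (a : OrientedMetric n I M) : Subgroup (Equiv.Perm M) where
  carrier := {f | ContMDiff I I ∞ f ∧ ContMDiff I I ∞ f.symm ∧ ∀ x, a.PreservedAt a f x}
  one_mem' := ⟨contMDiff_id, contMDiff_id, a.preservedAt_id⟩
  mul_mem' := by
    rintro f g ⟨hf, hf', hfp⟩ ⟨hg, hg', hgp⟩
    exact ⟨hf.comp hg, hg'.comp hf', fun x => (hfp (g x)).comp (hgp x)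
      (hf.mdifferentiable (by simp) _) (hg.mdifferentiable (by simp) _)⟩
  inv_mem' := by
    rintro f ⟨hf, hf', hfp⟩
    exact ⟨hf', hf, fun x => (hfp (f.symm x)).of_inverse (by ext y; simp)
      (hf.mdifferentiable (by simp) _) (hf'.mdifferentiable (by simp) _)⟩

end OrientedMetric

/-! ### Quotients by free, properly discontinuous groups of orientation-preserving isometries -/

section Quotients

variable {E : Type} [NormedAddCommGroup E] [NormedSpace ℝ E]
  {H : Type} [TopologicalSpace H] {I : ModelWithCorners ℝ E H}
  {X : Type} [TopologicalSpace X] [ChartedSpace H X] [T2Space X] [LocallyCompactSpace X]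
  {G : Type} [Group G] [MulAction G X]
  [ProperlyDiscontinuousSMul G X] [ContinuousConstSMul G X] [IsCancelSMul G X]

variable (I) in
/-- The differential of the projection `X → X / G` at a chosen point over `q`. -/
def quotientProjDeriv (q : MulAction.orbitRel.Quotient G X) :
    TangentSpace I (Quotient.out q) →L[ℝ] TangentSpace I q :=
  mfderiv I I (Quotient.mk (MulAction.orbitRel G X)) (Quotient.out q)

variable (I) in
/-- Inverse of `quotientProjDeriv` (the projection is a local diffeomorphism when `G` acts by
diffeomorphisms). -/
def quotientLiftDeriv (q : MulAction.orbitRel.Quotient G X) :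
    TangentSpace I q →L[ℝ] TangentSpace I (Quotient.out q) :=
  (quotientProjDeriv I q).inverse

/-- The metric and volume form induced on `X / G`; when `G` acts by orientation-preserving
isometries they do not depend on the chosen points of the orbits, and they are the unique ones for
which the projection `X → X / G` is an orientation-preserving local isometry. -/
def OrientedMetric.quotient {n : ℕ} (a : OrientedMetric n I X) (G : Type) [Group G] [MulAction G X]
    [ProperlyDiscontinuousSMul G X] [ContinuousConstSMul G X] [IsCancelSMul G X] :
    OrientedMetric n I (MulAction.orbitRel.Quotient G X) where
  metric q := (a.metric (Quotient.out q)).compl₁₂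
    (quotientLiftDeriv I q).toLinearMap (quotientLiftDeriv I q).toLinearMap
  vol q := (a.vol (Quotient.out q)).compLinearMap (quotientLiftDeriv I q).toLinearMap

end Quotients

/-! ### The round three-sphere and spherical space forms -/

/-- Euclidean four-space. -/
abbrev E4 : Type := EuclideanSpace ℝ (Fin 4)

/-- The three-sphere, as a smooth manifold. -/
abbrev S3 : Type := Metric.sphere (0 : E4) 1

/-- The round metric of constant sectional curvature `1/4` (four times the metric induced on the
unit sphere) with its volume form `8 det(x, ·, ·, ·)`, i.e. the orientation as the boundary of the
unit ball. -/
def roundS3 : OrientedMetric 3 (𝓡 3) S3 where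
  metric x :=
    let d := (mfderiv (𝓡 3) 𝓘(ℝ, E4) (Subtype.val : S3 → E4) x).toLinearMap
    (4 : ℝ) • (innerₗ E4).compl₁₂ d d
  vol x :=
    let d := (mfderiv (𝓡 3) 𝓘(ℝ, E4) (Subtype.val : S3 → E4) x).toLinearMap
    (8 : ℝ) •
      ((EuclideanSpace.basisFun (Fin 4) ℝ).toBasis.det.curryLeft (x : E4)).compLinearMap d

/-- Linear isometries act on the sphere. -/
instance instMulActionS3 : MulAction (E4 ≃ₗᵢ[ℝ] E4) S3 where
  smul A x := ⟨A x, by have := x.2; simp_all⟩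
  one_smul x := rfl
  mul_smul A B x := rfl

instance instContinuousConstSMulS3 : ContinuousConstSMul (E4 ≃ₗᵢ[ℝ] E4) S3 where
  continuous_const_smul A :=
    Continuous.subtype_mk (A.continuous.comp continuous_subtype_val) _

/-- `SO(4)`, the orientation-preserving isometry group of the round three-sphere. -/
def SO4 : Subgroup (E4 ≃ₗᵢ[ℝ] E4) where
  carrier := {A | LinearMap.det (A.toLinearEquiv : E4 →ₗ[ℝ] E4) = 1}
  one_mem' := LinearMap.det_id
  mul_mem' := by
    intro A B hA hB
    have : ((A * B).toLinearEquiv : E4 →ₗ[ℝ] E4)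
      = (A.toLinearEquiv : E4 →ₗ[ℝ] E4) * (B.toLinearEquiv : E4 →ₗ[ℝ] E4) := rfl
    simp only [Set.mem_ofPred_eq] at *
    rw [this, map_mul, hA, hB, one_mul]
  inv_mem' := by
    intro A hA
    simp only [Set.mem_ofPred_eq] at *
    have : ((A⁻¹).toLinearEquiv : E4 →ₗ[ℝ] E4) * (A.toLinearEquiv : E4 →ₗ[ℝ] E4) = 1 := by
      ext1 x; exact A.symm_apply_apply x
    have h2 := congrArg LinearMap.det this
    rwa [map_mul, hA, mul_one, map_one] at h2

section SpaceForm

instance instContinuousConstSMulSubgroupSO4 (Γ₀ : Subgroup SO4) : ContinuousConstSMul Γ₀ S3 where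
  continuous_const_smul γ := continuous_const_smul (γ.1.1 : E4 ≃ₗᵢ[ℝ] E4)

variable (Γ₀ : Subgroup SO4) [Finite Γ₀] [IsCancelSMul Γ₀ S3]

/-- The spherical space form `Σ = S³ / Γ₀` of a finite subgroup `Γ₀` of `SO(4)` that acts freely on
`S³` (freeness is `IsCancelSMul Γ₀ S3`). -/
abbrev SpaceForm : Type := MulAction.orbitRel.Quotient Γ₀ S3

/-- The metric and orientation of `S³ / Γ₀`. -/
def spaceFormMetric : OrientedMetric 3 (𝓡 3) (SpaceForm Γ₀) := roundS3.quotient Γ₀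

/-- `Iso(Σ)`, the group of orientation-preserving isometries of `Σ`. -/
abbrev SpaceForm.Iso : Type := (spaceFormMetric Γ₀).isoGroup (𝓡 3)

end SpaceForm

/-! ### Cylinders, and manifolds of type `S¹ × S³` -/

/-- The model of four-manifolds: the vector space `ℝ × ℝ³`. -/
abbrev J4 := 𝓘(ℝ, ℝ).prod (𝓡 3)

/-- The model space of four-manifolds. -/
abbrev H4 : Type := ModelProd ℝ (EuclideanSpace ℝ (Fin 3))

section Cylinder

variable {N : Type} [TopologicalSpace N] [ChartedSpace (EuclideanSpace ℝ (Fin 3)) N]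

/-- The one-form `dt` on `ℝ × N`. -/
def cylinderDt (x : ℝ × N) : TangentSpace J4 x →ₗ[ℝ] ℝ :=
  (mfderiv J4 𝓘(ℝ, ℝ) (Prod.fst : ℝ × N → ℝ) x).toLinearMap

/-- The differential of the projection `ℝ × N → N`. -/
def cylinderDsnd (x : ℝ × N) : TangentSpace J4 x →ₗ[ℝ] TangentSpace (𝓡 3) x.2 :=
  (mfderiv J4 (𝓡 3) (Prod.snd : ℝ × N → N) x).toLinearMap

/-- The Riemannian product `ℝ × N`: the metric `dt² + h` and the volume form `dt ∧ vol_h`. -/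
def OrientedMetric.cylinder (h : OrientedMetric 3 (𝓡 3) N) : OrientedMetric 4 J4 (ℝ × N) where
  metric x := (LinearMap.mul ℝ ℝ).compl₁₂ (cylinderDt x) (cylinderDt x) +
    (h.metric x.2).compl₁₂ (cylinderDsnd x) (cylinderDsnd x)
  vol x := AlternatingMap.alternatizeUncurryFin
    ((cylinderDt x).smulRight ((h.vol x.2).compLinearMap (cylinderDsnd x)))

/-- The vector field `∂/∂t` on `ℝ × N`. -/
def cylinderTime (x : ℝ × N) : TangentSpace J4 x :=
  mfderiv 𝓘(ℝ, ℝ) J4 (fun t : ℝ => ((t, x.2) : ℝ × N)) x.1 (1 : ℝ)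

end Cylinder

/-- A four-manifold with a metric and orientation and a vector field `time`. -/
structure TimedFourManifold where
  carrier : Type
  [topology : TopologicalSpace carrier]
  [charted : ChartedSpace H4 carrier]
  str : OrientedMetric 4 J4 carrier
  time : ∀ x : carrier, TangentSpace J4 x

attribute [instance] TimedFourManifold.topology TimedFourManifold.charted

/-- The cylinder `ℝ × N` over an oriented Riemannian three-manifold, with `∂/∂t`. -/
def cylinderManifold {N : Type} [TopologicalSpace N] [ChartedSpace (EuclideanSpace ℝ (Fin 3)) N]
    (h : OrientedMetric 3 (𝓡 3) N) : TimedFourManifold where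
  carrier := ℝ × N
  str := h.cylinder
  time := cylinderTime

namespace TimedFourManifold

/-- The differential of `F` at `x` is an orientation-preserving linear isometry that maps the vector
field of `M` to the one of `N`. -/
def PreservedAt (M N : TimedFourManifold) (F : M.carrier → N.carrier) (x : M.carrier) : Prop :=
  M.str.PreservedAt N.str F x ∧ mfderiv J4 J4 F x (M.time x) = N.time (F x)

/-- Isomorphism: there is an orientation-preserving diffeomorphism that pulls the metric of `N` back
to the metric of `M` and matches the vector fields. -/
def Isomorphic (M N : TimedFourManifold) : Prop :=
  ∃ F : M.carrier ≃ₘ^∞⟮J4, J4⟯ N.carrier, ∀ x, PreservedAt M N F x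

/-- Manifolds of type `S¹ × S³`: connected, oriented and time-oriented Riemannian four-manifolds
locally isometric to `ℝ × S³`, with `S³` of sectional curvature `1/4`. The time orientation is given
by the unit vector field which local isometries to `ℝ × S³` take to `± ∂/∂t`. Since `ℝ` and `S³` have
orientation-reversing isometries, local isometries may be chosen to preserve the orientation and to
take this vector field to `∂/∂t`. In particular the bilinear form of `M` is a smooth Riemannian metric,
its four-form is the smooth volume form of an orientation, and its vector field is smooth, of unit
length and parallel, because these tensors are locally pulled back from `ℝ × S³`. -/
structure IsTypeS1S3 (M : TimedFourManifold) : Prop where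
  t2 : T2Space M.carrier
  secondCountable : SecondCountableTopology M.carrier
  connected : ConnectedSpace M.carrier
  smooth : IsManifold J4 ∞ M.carrier
  locallyModelled : ∀ x : M.carrier,
    ∃ φ : PartialDiffeomorph J4 J4 M.carrier (cylinderManifold roundS3).carrier ∞,
      x ∈ φ.source ∧ ∀ y ∈ φ.source, PreservedAt M (cylinderManifold roundS3) φ y

theorem Isomorphic.refl (M : TimedFourManifold) : Isomorphic M M :=
  ⟨Diffeomorph.refl J4 M.carrier ∞, fun x => ⟨M.str.preservedAt_id x, by
    change mfderiv J4 J4 id x (M.time x) = M.time x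
    rw [mfderiv_id]; rfl⟩⟩

theorem Isomorphic.symm {M N : TimedFourManifold} (h : Isomorphic M N) : Isomorphic N M := by
  obtain ⟨F, hF⟩ := h
  have hFG : F ∘ F.symm = id := by ext y; simp
  have dF := F.contMDiff.mdifferentiable (by simp)
  have dG := F.symm.contMDiff.mdifferentiable (by simp)
  refine ⟨F.symm, fun y => ⟨(hF (F.symm y)).1.of_inverse hFG (dF _) (dG _), ?_⟩⟩
  have hGF : F.symm ∘ F = id := by ext y; simp
  obtain ⟨x, rfl⟩ := F.surjective y
  have h1 := (hF x).2
  change mfderiv J4 J4 F.symm (F x) (N.time (F x)) = M.time (F.symm (F x))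
  rw [← h1]
  have h := mfderiv_comp x (dG (F x)) (dF x)
  have h2 : mfderiv J4 J4 (F.symm ∘ F) x (M.time x)
      = mfderiv J4 J4 F.symm (F x) (mfderiv J4 J4 F x (M.time x)) := by rw [h]; rfl
  rw [← h2, hGF, mfderiv_id]
  have : F.symm (F x) = x := by simp
  rw [this]; rfl

theorem Isomorphic.trans {M N P : TimedFourManifold} (h : Isomorphic M N) (h' : Isomorphic N P) :
    Isomorphic M P := by
  obtain ⟨F, hF⟩ := h
  obtain ⟨G, hG⟩ := h'
  have dF := F.contMDiff.mdifferentiable (by simp)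
  have dG := G.contMDiff.mdifferentiable (by simp)
  refine ⟨F.trans G, fun x => ⟨(hG (F x)).1.comp (hF x).1 (dG _) (dF _), ?_⟩⟩
  have h := mfderiv_comp x (dG (F x)) (dF x)
  change mfderiv J4 J4 (G ∘ F) x (M.time x) = P.time (G (F x))
  rw [h, ← (hG (F x)).2, ← (hF x).2]; rfl

end TimedFourManifold

/-! ### The quotients `(ℝ × Σ) / ⟨(l, ψ)⟩` and the moduli set -/

section Suspension

variable (Γ₀ : Subgroup SO4) [Finite Γ₀] [IsCancelSMul Γ₀ S3]

/-- The isometry `(l, ψ) : (t, s) ↦ (t + l, ψ s)` of `ℝ × Σ`. -/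
def suspensionGenerator (l : ℝ) (ψ : SpaceForm.Iso Γ₀) : Equiv.Perm (ℝ × SpaceForm Γ₀) :=
  (Equiv.addRight l).prodCongr ψ.1

/-- The infinite cyclic group `⟨(l, ψ)⟩`. -/
def suspensionGroup (l : Set.Ioi (0 : ℝ)) (ψ : SpaceForm.Iso Γ₀) :
    Subgroup (Equiv.Perm (ℝ × SpaceForm Γ₀)) :=
  Subgroup.zpowers (suspensionGenerator Γ₀ l ψ)

variable {Γ₀} in
theorem suspensionGenerator_zpow (l : ℝ) (ψ : SpaceForm.Iso Γ₀) (k : ℤ)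
    (x : ℝ × SpaceForm Γ₀) :
    (suspensionGenerator Γ₀ l ψ ^ k) x = (x.1 + k * l, (ψ ^ k).1 x.2) := by
  have hnat : ∀ (m : ℕ) (x : ℝ × SpaceForm Γ₀),
      (suspensionGenerator Γ₀ l ψ ^ m) x = (x.1 + m * l, (ψ ^ m).1 x.2) := by
    intro m
    induction m with
    | zero => intro x; simp
    | succ m ih =>
      intro x
      rw [pow_succ, Equiv.Perm.mul_apply, ih, pow_succ]
      simp only [suspensionGenerator, Equiv.prodCongr_apply, Prod.map, Equiv.coe_addRight]
      refine Prod.ext ?_ rfl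
      push_cast; ring
  obtain ⟨m, rfl | rfl⟩ := k.eq_nat_or_neg
  · simpa using hnat m x
  · rw [zpow_neg, zpow_neg, Equiv.Perm.inv_eq_iff_eq, zpow_natCast, zpow_natCast, hnat]
    refine Prod.ext ?_ ?_
    · push_cast; ring
    · change x.2 = (ψ ^ m).1 ((ψ ^ m).1⁻¹ x.2)
      simp

instance instContinuousConstSMulSuspension (l : Set.Ioi (0 : ℝ)) (ψ : SpaceForm.Iso Γ₀) :
    ContinuousConstSMul (suspensionGroup Γ₀ l ψ) (ℝ × SpaceForm Γ₀) where
  continuous_const_smul := by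
    rintro ⟨γ, k, rfl⟩
    have : (fun x : ℝ × SpaceForm Γ₀ => (suspensionGenerator Γ₀ l ψ ^ k) x)
        = fun x => (x.1 + k * (l : ℝ), (ψ ^ k).1 x.2) :=
      funext (suspensionGenerator_zpow _ ψ k)
    change Continuous fun x : ℝ × SpaceForm Γ₀ => (suspensionGenerator Γ₀ l ψ ^ k) x
    rw [this]
    have hc : Continuous (ψ ^ k).1 := (ψ ^ k).2.1.continuous
    exact (continuous_fst.add continuous_const).prodMk (hc.comp continuous_snd)

instance instIsCancelSMulSuspension (l : Set.Ioi (0 : ℝ)) (ψ : SpaceForm.Iso Γ₀) :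
    IsCancelSMul (suspensionGroup Γ₀ l ψ) (ℝ × SpaceForm Γ₀) := by
  rw [isCancelSMul_iff_eq_one_of_smul_eq]
  rintro ⟨γ, k, rfl⟩ x hx
  have h1 : (suspensionGenerator Γ₀ l ψ ^ k) x = x := hx
  rw [suspensionGenerator_zpow] at h1
  have h2 : x.1 + k * (l : ℝ) = x.1 := congrArg Prod.fst h1
  have hl : (l : ℝ) ≠ 0 := ne_of_gt l.2
  have h3 : (k : ℝ) = 0 := by
    have : (k : ℝ) * l = 0 := by linarith
    exact (mul_eq_zero.mp this).resolve_right hl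
  have h4 : k = 0 := by exact_mod_cast h3
  subst h4
  exact Subtype.ext (zpow_zero _)

instance instProperlyDiscontinuousSuspension (l : Set.Ioi (0 : ℝ)) (ψ : SpaceForm.Iso Γ₀) :
    ProperlyDiscontinuousSMul (suspensionGroup Γ₀ l ψ) (ℝ × SpaceForm Γ₀) where
  finite_disjoint_inter_image := by
    intro K L hK hL
    have hl : (0 : ℝ) < l := l.2
    obtain ⟨a, ha⟩ := (hK.image continuous_fst).isBounded.exists_norm_le
    obtain ⟨b, hb⟩ := (hL.image continuous_fst).isBounded.exists_norm_le
    refine ((Set.finite_Icc (-⌈(a + b) / l⌉) ⌈(a + b) / (l : ℝ)⌉).image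
      (fun k : ℤ => (⟨suspensionGenerator Γ₀ l ψ ^ k, k, rfl⟩ : suspensionGroup Γ₀ l ψ))).subset ?_
    rintro ⟨γ, k, rfl⟩ hne
    refine ⟨k, ?_, rfl⟩
    obtain ⟨y, ⟨x, hx, hxy⟩, hy⟩ := hne
    have h1 : (suspensionGenerator Γ₀ l ψ ^ k) x = y := hxy
    rw [suspensionGenerator_zpow] at h1
    have h2 : x.1 + k * (l : ℝ) = y.1 := congrArg Prod.fst h1
    have h3 := ha x.1 ⟨x, hx, rfl⟩
    have h4 := hb y.1 ⟨y, hy, rfl⟩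
    rw [Real.norm_eq_abs, abs_le] at h3 h4
    have h5 : (k : ℝ) ≤ (a + b) / l := by rw [le_div_iff₀ hl]; linarith
    have h6 : -((a + b) / (l : ℝ)) ≤ k := by
      rw [← neg_div, div_le_iff₀ hl]; linarith
    constructor
    · have : -(⌈(a + b) / (l : ℝ)⌉ : ℝ) ≤ k := by linarith [Int.le_ceil ((a + b) / (l : ℝ))]
      exact_mod_cast this
    · have : (k : ℝ) ≤ ⌈(a + b) / (l : ℝ)⌉ := h5.trans (Int.le_ceil _)
      exact_mod_cast this

/-- The quotient `(ℝ × Σ) / ⟨(l, ψ)⟩`, with the metric and orientation induced from the product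
`ℝ × Σ` and the vector field induced by `∂/∂t`. -/
def suspension (l : Set.Ioi (0 : ℝ)) (ψ : SpaceForm.Iso Γ₀) : TimedFourManifold where
  carrier := MulAction.orbitRel.Quotient (suspensionGroup Γ₀ l ψ) (ℝ × SpaceForm Γ₀)
  str := (spaceFormMetric Γ₀).cylinder.quotient (suspensionGroup Γ₀ l ψ)
  time q := quotientProjDeriv J4 q (cylinderTime (Quotient.out q))

/-- `M` is of class `Σ`: it is isomorphic to `(ℝ × Σ) / ⟨(l, ψ)⟩` for some `l > 0` and `ψ`. -/
def TimedFourManifold.IsOfClass (M : TimedFourManifold) : Prop :=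
  ∃ (l : Set.Ioi (0 : ℝ)) (ψ : SpaceForm.Iso Γ₀), M.Isomorphic (suspension Γ₀ l ψ)

/-- Manifolds of type `S¹ × S³` and of class `Σ`. -/
def ManifoldOfClass : Type 1 :=
  {M : TimedFourManifold // M.IsTypeS1S3 ∧ M.IsOfClass Γ₀}

/-- Isomorphism of manifolds of type `S¹ × S³` and of class `Σ`. -/
instance ManifoldOfClass.setoid : Setoid (ManifoldOfClass Γ₀) where
  r M N := M.1.Isomorphic N.1
  iseqv := ⟨fun M => .refl M.1, .symm, .trans⟩

/-- The moduli set `𝔐(Σ)` of manifolds of type `S¹ × S³` and of class `Σ`. -/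
def ModuliSet : Type 1 := Quotient (ManifoldOfClass.setoid Γ₀)

end Suspension

end

/-!
The map `(l, [ψ]) ↦ [(ℝ × Σ) / ⟨(l, ψ)⟩]` is a bijection for the following reasons.

The projections `S³ → Σ` and `ℝ × Σ → (ℝ × Σ) / ⟨(l, ψ)⟩` are local diffeomorphisms
(`isLocalDiffeomorph_orbitMk`) which preserve the metric, the orientation and the time field
(`OrientedMetric.preservedAt_orbitMk`, `preservedAt_suspensionProj`). Local inverses of the
composite `ℝ × S³ → (ℝ × Σ) / ⟨(l, ψ)⟩` show that the quotient is a manifold of type `S¹ × S³`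
(`isTypeS1S3_suspension`). If `η` conjugates `ψ` to `ψ'`, then `id × η` descends to an isomorphism
of the quotients (`suspension_isomorphic_of_isConj`), so the map is well defined; it is surjective
by the definition of the class `Σ`.

For injectivity, let `F` be an isomorphism from the quotient of `(l, ψ)` to that of `(l', ψ')`,
and let `G` be its composite with `ℝ × Σ → (ℝ × Σ) / ⟨(l, ψ)⟩`. No homotopy theory is needed to
lift `G` to `ℝ × Σ`. A local lift preserves `∂/∂t` and the metric, hence also the dual form `dt`,
so it changes `t` by a constant (`exists_local_lift`). Since `ℝ × Σ` is connected, that constant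
is the same everywhere modulo `l'` (`exists_lift_fst_eq_add`). A point over `G x` is determined by
its `t`-coordinate, so prescribing `t + c` defines a global lift `(t, s) ↦ (t + c, η s)`; here `η`
does not depend on `t` because `∂/∂t` is preserved (`exists_lift`). Lifting the inverse of `F` in
the same way shows that `η` is an orientation-preserving isometry of `Σ`. Comparing generators
gives `l = k l'` and `η ψ η⁻¹ = ψ' ^ k`, and `l'` is likewise a multiple of `l`. By positivity
`k = 1`, so `l = l'` and `ψ` is conjugate to `ψ'` (`eq_and_isConj_of_isomorphic`).
-/

open scoped Topology

noncomputable section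

/-! ### Smooth quotients -/

section SmoothQuotient

open MulAction

variable {E : Type*} [NormedAddCommGroup E] [NormedSpace ℝ E]
  {H : Type*} [TopologicalSpace H] {I : ModelWithCorners ℝ E H} {n : ℕ∞ω}
  {X : Type*} [TopologicalSpace X] [ChartedSpace H X] [T2Space X] [LocallyCompactSpace X]
  {G : Type*} [Group G] [MulAction G X]
  [ProperlyDiscontinuousSMul G X] [ContinuousConstSMul G X] [IsCancelSMul G X]

theorem isLocalHomeomorph_orbitMk :
    IsLocalHomeomorph (Quotient.mk (orbitRel G X)) :=
  isQuotientCoveringMap_quotientMk_of_properlyDiscontinuousSMul.isCoveringMap.isLocalHomeomorph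

/-- A local section of `X → X / G`, precomposed with the projection, is locally the action of an
element of `G`. -/
theorem exists_localInverseAt_comp_orbitMk_eventuallyEq_smul {x u : X}
    (hu : Quotient.mk (orbitRel G X) u ∈
      ((isLocalHomeomorph_orbitMk (G := G) (X := X)).localInverseAt x).source) :
    ∃ g : G, (fun v => (isLocalHomeomorph_orbitMk (G := G) (X := X)).localInverseAt x
      (Quotient.mk (orbitRel G X) v)) =ᶠ[𝓝 u] fun v => g • v := by
  set hπ := isLocalHomeomorph_orbitMk (G := G) (X := X)
  set e := hπ.localInverseAt x
  have h1 : Quotient.mk (orbitRel G X) (e (Quotient.mk _ u)) = Quotient.mk _ u :=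
    hπ.apply_localInverseAt_of_mem hu
  obtain ⟨g, hg⟩ : ∃ g : G, g • u = e (Quotient.mk _ u) := Quotient.exact h1
  refine ⟨g, ?_⟩
  have hsrc : ∀ᶠ v in 𝓝 u, Quotient.mk (orbitRel G X) v ∈ e.source :=
    hπ.continuous.continuousAt.eventually (e.open_source.mem_nhds hu)
  have htgt : ∀ᶠ v in 𝓝 u, g • v ∈ e.target :=
    (continuous_const_smul g).continuousAt.eventually
      (e.open_target.mem_nhds (by rw [show (fun v => g • v) u = _ from hg]; exact e.map_source hu))
  filter_upwards [hsrc, htgt] with v hv hv'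
  refine hπ.injOn_localInverseAt_target (x := x) (e.map_source hv) hv' ?_
  rw [hπ.apply_localInverseAt_of_mem hv]
  exact (Quotient.sound ⟨g, rfl⟩ : Quotient.mk (orbitRel G X) (g • v) = Quotient.mk _ v).symm

theorem contMDiffAt_localInverseAt_comp_orbitMk (hG : ∀ g : G, ContMDiff I I n fun x : X => g • x)
    {x u : X} (hu : Quotient.mk (orbitRel G X) u ∈
      ((isLocalHomeomorph_orbitMk (G := G) (X := X)).localInverseAt x).source) :
    ContMDiffAt I I n (fun v => (isLocalHomeomorph_orbitMk (G := G) (X := X)).localInverseAt x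
      (Quotient.mk (orbitRel G X) v)) u := by
  obtain ⟨g, hg⟩ := exists_localInverseAt_comp_orbitMk_eventuallyEq_smul hu
  exact (hG g).contMDiffAt.congr_of_eventuallyEq hg

/-- The quotient of a manifold by a free, properly discontinuous smooth action is a manifold: the
transition maps are, up to charts of `X`, the actions of elements of `G`. -/
theorem isManifold_orbitRel_quotient [IsManifold I n X]
    (hG : ∀ g : G, ContMDiff I I n fun x : X => g • x) :
    IsManifold I n (orbitRel.Quotient G X) := by
  refine isManifold_of_contDiffOn I n _ ?_
  rintro e e' ⟨q, rfl⟩ ⟨q', rfl⟩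
  set hπ := isLocalHomeomorph_orbitMk (G := G) (X := X)
  generalize (Function.Surjective.hasRightInverse
    (Quotient.mk_surjective (s := orbitRel G X))).choose q = x
  generalize (Function.Surjective.hasRightInverse
    (Quotient.mk_surjective (s := orbitRel G X))).choose q' = x'
  rw [← contMDiffOn_iff_contDiffOn]
  refine I.contMDiff.comp_contMDiffOn ?_
  intro z hz
  refine ContMDiffWithinAt.comp (I' := I) z (t := Set.univ)
    (ContMDiffAt.contMDiffWithinAt ?_) ((I.contMDiffOn_symm z hz.2).mono Set.inter_subset_right)
    (fun _ _ => Set.mem_univ _)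
  have hz' := hz.1
  simp only [Set.mem_preimage, OpenPartialHomeomorph.trans_source,
    OpenPartialHomeomorph.symm_source, Set.mem_inter_iff,
    OpenPartialHomeomorph.trans_symm_eq_symm_trans_symm, OpenPartialHomeomorph.coe_trans,
    Function.comp_apply, IsLocalHomeomorph.localInverseAt_symm] at hz'
  obtain ⟨⟨h1, h2⟩, h3, h4⟩ := hz'
  have a1 : ContMDiffAt I I n (chartAt H x).symm (I.symm z) :=
    contMDiffOn_chart_symm.contMDiffAt ((chartAt H x).open_target.mem_nhds h1)
  have a2 := contMDiffAt_localInverseAt_comp_orbitMk hG h3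
  have a3 := (contMDiffOn_chart (I := I) (n := n) (x := x')).contMDiffAt
    ((chartAt H x').open_source.mem_nhds h4)
  have := ContMDiffAt.comp (I.symm z) (ContMDiffAt.comp _ a3 a2) a1
  refine this.congr_of_eventuallyEq (Filter.Eventually.of_forall fun w => ?_)
  simp

/-- The projection `X → X / G` is a local diffeomorphism. -/
theorem isLocalDiffeomorph_orbitMk [IsManifold I n X]
    (hG : ∀ g : G, ContMDiff I I n fun x : X => g • x) :
    IsLocalDiffeomorph I I n (Quotient.mk (orbitRel G X)) := by
  have := isManifold_orbitRel_quotient (I := I) (n := n) hG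
  set hπ := isLocalHomeomorph_orbitMk (G := G) (X := X)
  -- At the point chosen over `q` in the construction of the chart at `q`, the projection is a chart
  -- of `X` followed by the inverse of that chart. The group moves any point over `q` to this one.
  have key : ∀ q : orbitRel.Quotient G X, ∃ x : X, Quotient.mk _ x = q ∧
      IsLocalDiffeomorphAt I I n (Quotient.mk (orbitRel G X)) x := by
    intro q
    set hs := Function.Surjective.hasRightInverse (Quotient.mk_surjective (s := orbitRel G X))
    set x := hs.choose q with hx
    have hxq : Quotient.mk _ x = q := hs.choose_spec q
    refine ⟨x, hxq, ?_⟩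
    have hc : chartAt H q = (hπ.localInverseAt x).trans (chartAt H x) := rfl
    set e := hπ.localInverseAt x
    have hmem := (mem_chart_source H q)
    refine ⟨⟨((chartAt H x).trans (chartAt H q).symm).toPartialEquiv,
      ((chartAt H x).trans (chartAt H q).symm).open_source,
      ((chartAt H x).trans (chartAt H q).symm).open_target, ?_, ?_⟩, ?_, ?_⟩
    · exact (contMDiffOn_chart_symm (I := I) (n := n) (x := q)).comp
        ((contMDiffOn_chart (I := I) (n := n) (x := x)).mono Set.inter_subset_left)
        Set.inter_subset_right
    · exact (contMDiffOn_chart_symm (I := I) (n := n) (x := x)).comp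
        ((contMDiffOn_chart (I := I) (n := n) (x := q)).mono Set.inter_subset_left)
        Set.inter_subset_right
    · change x ∈ ((chartAt H x).trans (chartAt H q).symm).source
      rw [hc]
      simp [e]
    · intro y hy
      change y ∈ ((chartAt H x).trans (chartAt H q).symm).source at hy
      change _ = (chartAt H q).symm (chartAt H x y)
      rw [OpenPartialHomeomorph.trans_source] at hy
      rw [hc]
      simp [e, (chartAt H x).left_inv hy.1]
  intro x
  obtain ⟨y, hy, hd⟩ := key (Quotient.mk _ x)
  obtain ⟨g, hg⟩ : ∃ g : G, g • x = y := Quotient.exact hy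
  let D : X ≃ₘ^n⟮I, I⟯ X :=
    { toEquiv := MulAction.toPerm g
      contMDiff_toFun := hG g
      contMDiff_invFun := hG g⁻¹ }
  have h1 : IsLocalDiffeomorphAt I I n D x := D.isLocalDiffeomorph x
  have h2 : IsLocalDiffeomorphAt I I n (Quotient.mk (orbitRel G X)) (D x) := by
    change IsLocalDiffeomorphAt I I n _ (g • x)
    rwa [hg]
  have h3 := h1.comp (hg := h2)
  have h4 : Quotient.mk (orbitRel G X) ∘ D = Quotient.mk (orbitRel G X) :=
    funext fun v => Quotient.sound ⟨g, rfl⟩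
  rwa [h4] at h3

end SmoothQuotient

/-! ### Cancellation rules for maps that preserve the tensors -/

section Cancel

variable {E : Type} [NormedAddCommGroup E] [NormedSpace ℝ E]
  {H : Type} [TopologicalSpace H] {n : ℕ} {I : ModelWithCorners ℝ E H}
  {M N P : Type} [TopologicalSpace M] [ChartedSpace H M] [TopologicalSpace N] [ChartedSpace H N]
  [TopologicalSpace P] [ChartedSpace H P]

/-- If `G ∘ F` and `G` preserve the tensors, so does `F`. -/
theorem OrientedMetric.PreservedAt.of_comp_left {a : OrientedMetric n I M}
    {b : OrientedMetric n I N} {c : OrientedMetric n I P} {F : M → N} {G : N → P} {x : M}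
    (hGF : a.PreservedAt c (G ∘ F) x) (hG : b.PreservedAt c G (F x))
    (dG : MDifferentiableAt I I G (F x)) (dF : MDifferentiableAt I I F x) :
    a.PreservedAt b F x := by
  have h := mfderiv_comp x dG dF
  constructor
  · intro v w
    rw [← hGF.1, h]
    exact (hG.1 _ _).symm
  · intro v
    rw [← hGF.2, h]
    exact (hG.2 _).symm

/-- If `G ∘ F` and `F` preserve the tensors and the differential of `F` is onto, then `G` preserves
them. -/
theorem OrientedMetric.PreservedAt.of_comp_right {a : OrientedMetric n I M}
    {b : OrientedMetric n I N} {c : OrientedMetric n I P} {F : M → N} {G : N → P} {x : M}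
    (hGF : a.PreservedAt c (G ∘ F) x) (hF : a.PreservedAt b F x)
    (dG : MDifferentiableAt I I G (F x)) (dF : MDifferentiableAt I I F x)
    (surj : Function.Surjective (mfderiv I I F x)) :
    b.PreservedAt c G (F x) := by
  have h := mfderiv_comp x dG dF
  constructor
  · intro v w
    obtain ⟨v, rfl⟩ := surj v
    obtain ⟨w, rfl⟩ := surj w
    rw [hF.1, ← hGF.1, h]
    rfl
  · intro v
    choose u hu using fun i => surj (v i)
    obtain rfl : (fun i => mfderiv I I F x (u i)) = v := funext hu
    rw [hF.2, ← hGF.2, h]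
    rfl

theorem OrientedMetric.PreservedAt.congr {a : OrientedMetric n I M}
    {b : OrientedMetric n I N} {F G : M → N} {x : M} (hF : a.PreservedAt b F x)
    (h : G =ᶠ[𝓝 x] F) : a.PreservedAt b G x := by
  have h1 := h.mfderiv_eq (I := I) (I' := I)
  have h2 := h.eq_of_nhds
  unfold OrientedMetric.PreservedAt at *
  rw [h1, h2]
  exact hF

end Cancel

theorem IsLocalDiffeomorphAt.mfderiv_bijective {E : Type*} [NormedAddCommGroup E]
    [NormedSpace ℝ E] {H : Type*} [TopologicalSpace H] {I : ModelWithCorners ℝ E H}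
    {M N : Type*} [TopologicalSpace M] [ChartedSpace H M] [TopologicalSpace N] [ChartedSpace H N]
    {f : M → N} {x : M} (hf : IsLocalDiffeomorphAt I I ∞ f x) :
    Function.Bijective (mfderiv I I f x) :=
  (hf.mfderivToContinuousLinearEquiv (by simp)).bijective

namespace TimedFourManifold

variable {M N P : TimedFourManifold}

theorem PreservedAt.comp {F : M.carrier → N.carrier}
    {G : N.carrier → P.carrier} {x : M.carrier} (hG : PreservedAt N P G (F x))
    (hF : PreservedAt M N F x)
    (dG : MDifferentiableAt J4 J4 G (F x)) (dF : MDifferentiableAt J4 J4 F x) :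
    PreservedAt M P (G ∘ F) x := by
  refine ⟨hG.1.comp hF.1 dG dF, ?_⟩
  rw [mfderiv_comp x dG dF]
  exact (congrArg (mfderiv J4 J4 G (F x)) hF.2).trans hG.2

theorem PreservedAt.of_comp_left {F : M.carrier → N.carrier}
    {G : N.carrier → P.carrier} {x : M.carrier} (hGF : PreservedAt M P (G ∘ F) x)
    (hG : PreservedAt N P G (F x))
    (dG : MDifferentiableAt J4 J4 G (F x)) (dF : MDifferentiableAt J4 J4 F x)
    (inj : Function.Injective (mfderiv J4 J4 G (F x))) : PreservedAt M N F x := by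
  refine ⟨hGF.1.of_comp_left hG.1 dG dF, inj ?_⟩
  have h := hGF.2
  rw [mfderiv_comp x dG dF] at h
  exact h.trans hG.2.symm

theorem PreservedAt.of_comp_right {F : M.carrier → N.carrier}
    {G : N.carrier → P.carrier} {x : M.carrier} (hGF : PreservedAt M P (G ∘ F) x)
    (hF : PreservedAt M N F x)
    (dG : MDifferentiableAt J4 J4 G (F x)) (dF : MDifferentiableAt J4 J4 F x)
    (surj : Function.Surjective (mfderiv J4 J4 F x)) : PreservedAt N P G (F x) := by
  refine ⟨hGF.1.of_comp_right hF.1 dG dF surj, ?_⟩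
  have h := hGF.2
  rw [mfderiv_comp x dG dF] at h
  rw [← hF.2]
  exact h

theorem PreservedAt.congr {F G : M.carrier → N.carrier} {x : M.carrier}
    (hF : PreservedAt M N F x) (h : G =ᶠ[𝓝 x] F) : PreservedAt M N G x := by
  refine ⟨hF.1.congr h, ?_⟩
  have h1 := h.mfderiv_eq (I := J4) (I' := J4)
  have h2 := h.eq_of_nhds
  rw [h1, h2]
  exact hF.2

end TimedFourManifold

/-! ### The projection onto a quotient preserves the tensors -/

section QuotientTensors

open MulAction

variable {E : Type} [NormedAddCommGroup E] [NormedSpace ℝ E]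
  {H : Type} [TopologicalSpace H] {I : ModelWithCorners ℝ E H}
  {X : Type} [TopologicalSpace X] [ChartedSpace H X] [T2Space X] [LocallyCompactSpace X]
  {G : Type} [Group G] [MulAction G X]
  [ProperlyDiscontinuousSMul G X] [ContinuousConstSMul G X] [IsCancelSMul G X]

theorem mfderiv_orbitMk_smul [IsManifold I ∞ X]
    (hG : ∀ g : G, ContMDiff I I ∞ fun x : X => g • x) (g : G) (x : X) (v : TangentSpace I x) :
    mfderiv I I (Quotient.mk (orbitRel G X)) (g • x) (mfderiv I I (fun x : X => g • x) x v) =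
      mfderiv I I (Quotient.mk (orbitRel G X)) x v := by
  have hd := (isLocalDiffeomorph_orbitMk (I := I) hG).mdifferentiable (by simp)
  have h := mfderiv_comp (I := I) (I' := I) (I'' := I) (f := fun x : X => g • x) x (hd (g • x))
    ((hG g).mdifferentiable (by simp) x)
  have h4 : Quotient.mk (orbitRel G X) ∘ (fun x : X => g • x) = Quotient.mk (orbitRel G X) :=
    funext fun v => Quotient.sound ⟨g, rfl⟩
  rw [h4] at h
  rw [h]
  rfl

/-- The lift of `dπ v` to the chosen point `g • x` of the orbit of `x` is the image of `v` under the
differential of `g`. -/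
theorem quotientLiftDeriv_orbitMk [IsManifold I ∞ X]
    (hG : ∀ g : G, ContMDiff I I ∞ fun x : X => g • x) {x : X} {g : G}
    (hg : g • x = Quotient.out (Quotient.mk (orbitRel G X) x)) (v : TangentSpace I x) :
    (quotientLiftDeriv I (Quotient.mk (orbitRel G X) x)
      (mfderiv I I (Quotient.mk (orbitRel G X)) x v) : E) =
      mfderiv I I (fun x : X => g • x) x v := by
  have hloc := isLocalDiffeomorph_orbitMk (I := I) hG
  set q := Quotient.mk (orbitRel G X) x
  have hinv : (quotientProjDeriv I q).IsInvertible :=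
    ⟨(hloc (Quotient.out q)).mfderivToContinuousLinearEquiv (by simp), rfl⟩
  unfold quotientLiftDeriv
  refine (hinv.inverse_apply_eq).2 ?_
  rw [← mfderiv_orbitMk_smul hG g x v]
  unfold quotientProjDeriv
  rw [← hg]
  rfl

/-- When `G` preserves the metric and the volume form, the projection to `X / G` preserves them at
every point, not only at the chosen representatives that define the tensors of `X / G`. -/
theorem OrientedMetric.preservedAt_orbitMk [IsManifold I ∞ X] {n : ℕ} (a : OrientedMetric n I X)
    (hG : ∀ g : G, ContMDiff I I ∞ fun x : X => g • x)
    (ha : ∀ (g : G) (x : X), a.PreservedAt a (fun x : X => g • x) x) (x : X) :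
    a.PreservedAt (a.quotient G) (Quotient.mk (orbitRel G X)) x := by
  obtain ⟨g, hg⟩ : ∃ g : G, g • x = Quotient.out (Quotient.mk (orbitRel G X) x) :=
    Quotient.exact (Quotient.out_eq (Quotient.mk (orbitRel G X) x))
  have hL := quotientLiftDeriv_orbitMk (I := I) hG hg
  constructor
  · intro v w
    rw [← (ha g x).1 v w]
    have hy : ∀ y : X, g • x = y → ∀ v w : E, a.metric y v w = a.metric (g • x) v w := by
      rintro _ rfl v w; rfl
    refine Eq.trans (hy _ hg _ _) ?_
    exact congrArg₂ (fun v w : E => a.metric (g • x) v w) (hL v) (hL w)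
  · intro v
    rw [← (ha g x).2 v]
    have hy : ∀ y : X, g • x = y → ∀ v : Fin n → E, a.vol y v = a.vol (g • x) v := by
      rintro _ rfl v; rfl
    refine Eq.trans (hy _ hg _) ?_
    exact congrArg (fun v : Fin n → E => a.vol (g • x) v) (funext fun i => hL (v i))

end QuotientTensors

/-! ### Riemannian cylinders -/

section CylinderTensors

variable {N N' : Type} [TopologicalSpace N] [ChartedSpace (EuclideanSpace ℝ (Fin 3)) N]
  [TopologicalSpace N'] [ChartedSpace (EuclideanSpace ℝ (Fin 3)) N']

/-- The vector space `ℝ × ℝ³` to which every tangent space of `ℝ × N` unfolds. Writing tangent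
vectors as elements of this type gives access to their components. -/
abbrev E31 : Type := ℝ × EuclideanSpace ℝ (Fin 3)

theorem cylinderDt_apply (x : ℝ × N) (v : E31) : cylinderDt x v = v.1 := by
  unfold cylinderDt
  rw [mfderiv_fst]
  rfl

theorem cylinderDsnd_apply (x : ℝ × N) (v : E31) : cylinderDsnd x v = v.2 := by
  unfold cylinderDsnd
  rw [mfderiv_snd]
  rfl

theorem cylinderTime_eq (x : ℝ × N) : cylinderTime x = ((1, 0) : E31) := by
  unfold cylinderTime
  rw [mfderiv_prod_left]
  rfl

theorem OrientedMetric.cylinder_metric_apply (h : OrientedMetric 3 (𝓡 3) N) (x : ℝ × N)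
    (v w : E31) : h.cylinder.metric x v w = v.1 * w.1 + h.metric x.2 v.2 w.2 := by
  change cylinderDt x v * cylinderDt x w + h.metric x.2 (cylinderDsnd x v) (cylinderDsnd x w) = _
  simp only [cylinderDt_apply, cylinderDsnd_apply]

theorem OrientedMetric.cylinder_vol_apply (h : OrientedMetric 3 (𝓡 3) N) (x : ℝ × N)
    (v : Fin 4 → E31) : h.cylinder.vol x v =
      ∑ i : Fin 4, (-1 : ℤ) ^ (i : ℕ) • ((v i).1 * h.vol x.2 (fun j => (i.removeNth v j).2)) := by
  refine (AlternatingMap.alternatizeUncurryFin_apply _ _).trans ?_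
  refine Finset.sum_congr rfl fun i _ => ?_
  congr 1
  change cylinderDt x (v i) * h.vol x.2 (fun j => cylinderDsnd x (i.removeNth v j)) = _
  simp only [cylinderDt_apply, cylinderDsnd_apply]

/-- Inserting `∂/∂t` into the volume form of a cylinder gives the volume form of the base. -/
theorem OrientedMetric.cylinder_vol_cons_time (h : OrientedMetric 3 (𝓡 3) N) (x : ℝ × N)
    (v : Fin 4 → E31) (w : Fin 3 → EuclideanSpace ℝ (Fin 3)) (h0 : v 0 = (1, 0))
    (hs : ∀ i, v (Fin.succ i) = (0, w i)) : h.cylinder.vol x v = h.vol x.2 w := by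
  refine (OrientedMetric.cylinder_vol_apply h x v).trans ?_
  rw [Fin.sum_univ_succ]
  simp [h0, hs, Fin.removeNth]

variable (c : ℝ) {f : N → N'}

theorem mfderiv_translate_prodMap {x : ℝ × N} (hf : MDifferentiableAt (𝓡 3) (𝓡 3) f x.2)
    (v : E31) : (mfderiv J4 J4 (Prod.map (· + c) f) x v : E31) =
      (v.1, mfderiv (𝓡 3) (𝓡 3) f x.2 v.2) := by
  have h1 : HasMFDerivAt 𝓘(ℝ, ℝ) 𝓘(ℝ, ℝ) (fun t : ℝ => t + c) x.1
      (ContinuousLinearMap.id ℝ ℝ) :=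
    ((hasFDerivAt_id x.1).add_const c).hasMFDerivAt
  rw [mfderiv_prodMap h1.mdifferentiableAt hf, h1.mfderiv]
  rfl

theorem OrientedMetric.PreservedAt.cylinder {h : OrientedMetric 3 (𝓡 3) N}
    {h' : OrientedMetric 3 (𝓡 3) N'} {x : ℝ × N} (hp : h.PreservedAt h' f x.2)
    (hf : MDifferentiableAt (𝓡 3) (𝓡 3) f x.2) :
    h.cylinder.PreservedAt h'.cylinder (Prod.map (· + c) f) x := by
  let D : E31 → E31 := fun v => mfderiv J4 J4 (Prod.map (· + c) f) x v
  have hD : D = fun v => (v.1, mfderiv (𝓡 3) (𝓡 3) f x.2 v.2) :=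
    funext (mfderiv_translate_prodMap c hf)
  constructor
  · intro v w
    change h'.cylinder.metric _ (D v) (D w) = _
    refine (OrientedMetric.cylinder_metric_apply h' _ _ _).trans ?_
    refine Eq.trans ?_ (OrientedMetric.cylinder_metric_apply h _ _ _).symm
    rw [hD]
    exact congrArg _ (hp.1 _ _)
  · intro v
    change h'.cylinder.vol _ (fun i => D (v i)) = _
    refine (OrientedMetric.cylinder_vol_apply h' _ _).trans ?_
    refine Eq.trans ?_ (OrientedMetric.cylinder_vol_apply h _ _).symm
    refine Finset.sum_congr rfl fun i _ => ?_
    rw [hD]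
    let u : Fin 4 → E31 := v
    exact congrArg (fun r => (-1 : ℤ) ^ (i : ℕ) • ((u i).1 * r))
      (hp.2 fun j => (i.removeNth u j).2)

/-- The converse of `OrientedMetric.PreservedAt.cylinder`: the tensors of the base are recovered by
restricting the metric to vectors tangent to the base and by inserting `∂/∂t` into the volume
form. -/
theorem OrientedMetric.PreservedAt.of_cylinder {h : OrientedMetric 3 (𝓡 3) N}
    {h' : OrientedMetric 3 (𝓡 3) N'} {x : ℝ × N}
    (hp : h.cylinder.PreservedAt h'.cylinder (Prod.map (· + c) f) x)
    (hf : MDifferentiableAt (𝓡 3) (𝓡 3) f x.2) : h.PreservedAt h' f x.2 := by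
  let D : E31 → E31 := fun v => mfderiv J4 J4 (Prod.map (· + c) f) x v
  have hD : D = fun v => (v.1, mfderiv (𝓡 3) (𝓡 3) f x.2 v.2) :=
    funext (mfderiv_translate_prodMap c hf)
  constructor
  · intro v w
    have h1 : h'.cylinder.metric _ (D (0, v)) (D (0, w)) = _ :=
      hp.1 ((0, v) : E31) ((0, w) : E31)
    replace h1 := ((OrientedMetric.cylinder_metric_apply h' _ _ _).symm.trans h1).trans
      (OrientedMetric.cylinder_metric_apply h _ _ _)
    rw [hD] at h1
    simpa using! h1
  · intro v
    let u : Fin 4 → E31 := Fin.cons ((1, 0) : E31) fun i => ((0, v i) : E31)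
    have h1 : h'.cylinder.vol _ (fun i => D (u i)) = h.cylinder.vol x u := hp.2 u
    rw [hD] at h1
    refine Eq.trans (Eq.trans ?_ h1)
      (OrientedMetric.cylinder_vol_cons_time h x u v rfl fun i => rfl)
    refine (OrientedMetric.cylinder_vol_cons_time h' (Prod.map (· + c) f x)
      (fun i => ((u i).1, mfderiv (𝓡 3) (𝓡 3) f x.2 (u i).2))
      (fun i => mfderiv (𝓡 3) (𝓡 3) f x.2 (v i)) ?_ fun i => rfl).symm
    exact Prod.ext rfl (map_zero (mfderiv (𝓡 3) (𝓡 3) f x.2))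

theorem preservedAt_cylinderManifold {h : OrientedMetric 3 (𝓡 3) N}
    {h' : OrientedMetric 3 (𝓡 3) N'} {x : ℝ × N} (hp : h.PreservedAt h' f x.2)
    (hf : MDifferentiableAt (𝓡 3) (𝓡 3) f x.2) :
    TimedFourManifold.PreservedAt (cylinderManifold h) (cylinderManifold h')
      (Prod.map (· + c) f) x := by
  refine ⟨hp.cylinder c hf, ?_⟩
  change mfderiv J4 J4 (Prod.map (· + c) f) x (cylinderTime x) = cylinderTime _
  rw [cylinderTime_eq]
  refine (mfderiv_translate_prodMap c hf _).trans ?_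
  refine Eq.trans ?_ (cylinderTime_eq _).symm
  exact Prod.ext rfl (map_zero (mfderiv (𝓡 3) (𝓡 3) f x.2))

end CylinderTensors

/-! ### Maps with vanishing differential -/

section LocallyConstant

variable {E E' : Type*} [NormedAddCommGroup E] [NormedSpace ℝ E] [NormedAddCommGroup E']
  [NormedSpace ℝ E'] {H H' : Type*} [TopologicalSpace H] [TopologicalSpace H']
  {I : ModelWithCorners ℝ E H} {I' : ModelWithCorners ℝ E' H'} [I.Boundaryless]
  {M M' : Type*} [TopologicalSpace M] [ChartedSpace H M] [IsManifold I 1 M]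
  [TopologicalSpace M'] [ChartedSpace H' M'] [IsManifold I' 1 M']

/-- A map whose differential vanishes near `x` is constant near `x`. -/
theorem eventually_eq_of_mfderiv_eq_zero {f : M → M'} {x : M}
    (hf : ∀ᶠ y in 𝓝 x, MDifferentiableAt I I' f y) (h0 : ∀ᶠ y in 𝓝 x, mfderiv I I' f y = 0) :
    ∀ᶠ y in 𝓝 x, f y = f x := by
  have hcont : ContinuousAt f x := hf.self_of_nhds.continuousAt
  have hsrc : ∀ᶠ y in 𝓝 x, f y ∈ (chartAt H' (f x)).source :=
    hcont.eventually ((chartAt H' (f x)).open_source.mem_nhds (mem_chart_source H' (f x)))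
  -- The representation of `f` in the charts at `x` and `f x`.
  let g : E → E' := fun z => extChartAt I' (f x) (f ((extChartAt I x).symm z))
  have hsymm : ContinuousAt (extChartAt I x).symm (extChartAt I x x) :=
    continuousAt_extChartAt_symm x
  have hback : (extChartAt I x).symm (extChartAt I x x) = x := extChartAt_to_inv x
  have hev : ∀ᶠ z in 𝓝 (extChartAt I x x), DifferentiableAt ℝ g z ∧ fderiv ℝ g z = 0 := by
    have h1 : ∀ᶠ z in 𝓝 (extChartAt I x x), z ∈ (extChartAt I x).target :=
      extChartAt_target_mem_nhds x
    have h2 := (hsymm.tendsto.eventually (by rw [hback]; exact hf.and (h0.and hsrc)))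
    filter_upwards [h1.eventually_nhds, h2] with z hz ⟨hz1, hz2, hz3⟩
    have d1 : MDifferentiableAt 𝓘(ℝ, E) I (extChartAt I x).symm z :=
      ((contMDiffOn_extChartAt_symm (n := 1) x).contMDiffAt hz).mdifferentiableAt (by simp)
    have d3 : MDifferentiableAt I' 𝓘(ℝ, E') (extChartAt I' (f x))
        (f ((extChartAt I x).symm z)) :=
      (contMDiffAt_extChartAt' (n := 1) hz3).mdifferentiableAt (by simp)
    have d12 := hz1.comp z d1
    have d := d3.comp z d12
    refine ⟨d.differentiableAt, ?_⟩
    rw [← mfderiv_eq_fderiv]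
    refine (mfderiv_comp z d3 d12).trans ?_
    rw [mfderiv_comp z hz1 d1, hz2]
    ext v
    exact map_zero (mfderiv I' 𝓘(ℝ, E') (extChartAt I' (f x)) (f ((extChartAt I x).symm z)))
  obtain ⟨r, hr, hball⟩ := Metric.eventually_nhds_iff_ball.1 hev
  have hconst : ∀ z ∈ Metric.ball (extChartAt I x x) r, g z = g (extChartAt I x x) :=
    fun z hz => Metric.isOpen_ball.is_const_of_fderiv_eq_zero
      (convex_ball _ _).isPreconnected
      (fun z hz => (hball z hz).1.differentiableWithinAt) (fun z hz => (hball z hz).2) hz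
      (Metric.mem_ball_self hr)
  have h3 : ∀ᶠ y in 𝓝 x, extChartAt I x y ∈ Metric.ball (extChartAt I x x) r :=
    (continuousAt_extChartAt x).eventually (Metric.ball_mem_nhds _ hr)
  filter_upwards [h3, hsrc, extChartAt_source_mem_nhds (I := I) x] with y hy hy1 hy2
  have h4 := hconst _ hy
  simp only [g, (extChartAt I x).left_inv hy2, hback] at h4
  exact (extChartAt I' (f x)).injOn (by rwa [extChartAt_source]) (mem_extChartAt_source _) h4

/-- A differentiable map with vanishing differential on a connected manifold is constant. -/
theorem eq_of_mfderiv_eq_zero [PreconnectedSpace M] [T1Space M'] {f : M → M'}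
    (hf : MDifferentiable I I' f) (h0 : ∀ y, mfderiv I I' f y = 0) (x y : M) : f x = f y := by
  have : IsLocallyConstant f := (IsLocallyConstant.iff_eventually_eq f).2 fun x =>
    eventually_eq_of_mfderiv_eq_zero (.of_forall hf) (.of_forall h0)
  exact this.apply_eq_of_preconnectedSpace x y

end LocallyConstant

/-! ### Products of local diffeomorphisms -/

theorem IsLocalDiffeomorphAt.prodMap {𝕜 : Type*} [NontriviallyNormedField 𝕜]
    {E₁ E₂ F₁ F₂ : Type*} [NormedAddCommGroup E₁] [NormedSpace 𝕜 E₁] [NormedAddCommGroup E₂]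
    [NormedSpace 𝕜 E₂] [NormedAddCommGroup F₁] [NormedSpace 𝕜 F₁] [NormedAddCommGroup F₂]
    [NormedSpace 𝕜 F₂] {H₁ H₂ K₁ K₂ : Type*} [TopologicalSpace H₁] [TopologicalSpace H₂]
    [TopologicalSpace K₁] [TopologicalSpace K₂] {I₁ : ModelWithCorners 𝕜 E₁ H₁}
    {I₂ : ModelWithCorners 𝕜 E₂ H₂} {J₁ : ModelWithCorners 𝕜 F₁ K₁}
    {J₂ : ModelWithCorners 𝕜 F₂ K₂} {M₁ M₂ N₁ N₂ : Type*} [TopologicalSpace M₁]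
    [ChartedSpace H₁ M₁] [TopologicalSpace M₂] [ChartedSpace H₂ M₂] [TopologicalSpace N₁]
    [ChartedSpace K₁ N₁] [TopologicalSpace N₂] [ChartedSpace K₂ N₂] {n : ℕ∞ω}
    {f : M₁ → N₁} {g : M₂ → N₂} {x : M₁ × M₂} (hf : IsLocalDiffeomorphAt I₁ J₁ n f x.1)
    (hg : IsLocalDiffeomorphAt I₂ J₂ n g x.2) :
    IsLocalDiffeomorphAt (I₁.prod I₂) (J₁.prod J₂) n (Prod.map f g) x := by
  obtain ⟨Φ, hx, hΦ⟩ := hf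
  obtain ⟨Ψ, hy, hΨ⟩ := hg
  refine ⟨⟨Φ.toPartialEquiv.prod Ψ.toPartialEquiv, Φ.open_source.prod Ψ.open_source,
    Φ.open_target.prod Ψ.open_target, Φ.contMDiffOn_toFun.prodMap Ψ.contMDiffOn_toFun,
    Φ.contMDiffOn_invFun.prodMap Ψ.contMDiffOn_invFun⟩, ⟨hx, hy⟩, ?_⟩
  intro y hy
  exact Prod.ext (hΦ hy.1) (hΨ hy.2)

/-! ### The round three-sphere and its space forms -/

theorem contMDiff_coe_S3 {m : ℕ∞ω} :
    ContMDiff (𝓡 3) 𝓘(ℝ, E4) m (Subtype.val : S3 → E4) :=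
  haveI := Fact.mk (finrank_euclideanSpace_fin (𝕜 := ℝ) (n := 3 + 1))
  contMDiff_coe_sphere

theorem contMDiff_smul_S3 (A : E4 ≃ₗᵢ[ℝ] E4) : ContMDiff (𝓡 3) (𝓡 3) ∞ fun x : S3 => A • x := by
  have h : ContMDiff (𝓡 3) 𝓘(ℝ, E4) ∞ fun x : S3 => A (x : E4) :=
    A.toContinuousLinearEquiv.contDiff.contMDiff.comp contMDiff_coe_S3
  have := Fact.mk (finrank_euclideanSpace_fin (𝕜 := ℝ) (n := 3 + 1))
  exact h.codRestrict_sphere fun x => (A • x).2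

theorem mfderiv_coe_smul_S3 (A : E4 ≃ₗᵢ[ℝ] E4) (x : S3) (v : TangentSpace (𝓡 3) x) :
    (mfderiv (𝓡 3) 𝓘(ℝ, E4) (Subtype.val : S3 → E4) (A • x)
      (mfderiv (𝓡 3) (𝓡 3) (fun x : S3 => A • x) x v) : E4) =
    A (mfderiv (𝓡 3) 𝓘(ℝ, E4) (Subtype.val : S3 → E4) x v : E4) := by
  have dv : ∀ y : S3, MDifferentiableAt (𝓡 3) 𝓘(ℝ, E4) (Subtype.val : S3 → E4) y :=
    fun y => (contMDiff_coe_S3 (m := 1)).mdifferentiable (by simp) y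
  have h1 := mfderiv_comp x (dv (A • x)) ((contMDiff_smul_S3 A).mdifferentiable (by simp) x)
  have hA : HasMFDerivAt 𝓘(ℝ, E4) 𝓘(ℝ, E4) A (x : E4)
      (A.toContinuousLinearEquiv : E4 →L[ℝ] E4) :=
    (A.toContinuousLinearEquiv.hasFDerivAt).hasMFDerivAt
  have h2 := mfderiv_comp x hA.mdifferentiableAt (dv x)
  rw [hA.mfderiv] at h2
  have h3 : (Subtype.val : S3 → E4) ∘ (fun x : S3 => A • x) = A ∘ (Subtype.val : S3 → E4) := rfl
  rw [h3, h2] at h1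
  exact (congrArg (fun L => L v) h1).symm

/-- `SO(4)` preserves the round metric, and it preserves the volume form `8 det(x, ·, ·, ·)` because
its elements have determinant one. -/
theorem preservedAt_smul_roundS3 {A : E4 ≃ₗᵢ[ℝ] E4} (hA : A ∈ SO4) (x : S3) :
    roundS3.PreservedAt roundS3 (fun x : S3 => A • x) x := by
  constructor
  · intro v w
    change (4 : ℝ) * inner ℝ (_ : E4) (_ : E4) = (4 : ℝ) * inner ℝ (_ : E4) (_ : E4)
    refine congrArg ((4 : ℝ) * ·) ?_
    refine Eq.trans ?_ (A.inner_map_map _ _)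
    exact congrArg₂ (fun a b : E4 => inner ℝ a b) (mfderiv_coe_smul_S3 A x v)
      (mfderiv_coe_smul_S3 A x w)
  · intro v
    let b := (EuclideanSpace.basisFun (Fin 4) ℝ).toBasis
    let d : ∀ y : S3, TangentSpace (𝓡 3) y → E4 := fun y u =>
      mfderiv (𝓡 3) 𝓘(ℝ, E4) (Subtype.val : S3 → E4) y u
    change (8 : ℝ) * b.det (Matrix.vecCons (A x : E4)
      fun i => d (A • x) (mfderiv (𝓡 3) (𝓡 3) (fun x : S3 => A • x) x (v i))) =
      (8 : ℝ) * b.det (Matrix.vecCons (x : E4) fun i => d x (v i))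
    refine congrArg ((8 : ℝ) * ·) ?_
    have h := b.det_comp (A.toLinearEquiv : E4 →ₗ[ℝ] E4)
      (Matrix.vecCons (x : E4) fun i => d x (v i))
    rw [show LinearMap.det (A.toLinearEquiv : E4 →ₗ[ℝ] E4) = 1 from hA, one_mul] at h
    rw [← h]
    congr 1
    funext i
    refine Fin.cases rfl (fun j => ?_) i
    exact mfderiv_coe_smul_S3 A x (v j)

instance instConnectedSpaceS3 : ConnectedSpace S3 := by
  refine isConnected_iff_connectedSpace.1 (isConnected_sphere ?_ _ zero_le_one)
  rw [← Module.finrank_eq_rank]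
  simp

theorem contMDiff_smul_subgroup (Γ₀ : Subgroup SO4) (γ : Γ₀) :
    ContMDiff (𝓡 3) (𝓡 3) ∞ fun x : S3 => γ • x :=
  contMDiff_smul_S3 γ.1.1

section SpaceFormGeometry

variable (Γ₀ : Subgroup SO4) [Finite Γ₀] [IsCancelSMul Γ₀ S3]

instance instIsManifoldSpaceForm : IsManifold (𝓡 3) ∞ (SpaceForm Γ₀) :=
  isManifold_orbitRel_quotient (contMDiff_smul_subgroup Γ₀)

instance instConnectedSpaceSpaceForm : ConnectedSpace (SpaceForm Γ₀) :=
  inferInstanceAs (ConnectedSpace (Quotient (MulAction.orbitRel Γ₀ S3)))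

instance instSecondCountableSpaceForm : SecondCountableTopology (SpaceForm Γ₀) :=
  ContinuousConstSMul.secondCountableTopology (Γ := Γ₀) (T := S3)

/-- The projection `S³ → Σ`. -/
def spaceFormProj : S3 → SpaceForm Γ₀ := Quotient.mk (MulAction.orbitRel Γ₀ S3)

theorem isLocalDiffeomorph_spaceFormProj :
    IsLocalDiffeomorph (𝓡 3) (𝓡 3) ∞ (spaceFormProj Γ₀) :=
  isLocalDiffeomorph_orbitMk (contMDiff_smul_subgroup Γ₀)

theorem preservedAt_spaceFormProj (x : S3) :
    roundS3.PreservedAt (spaceFormMetric Γ₀) (spaceFormProj Γ₀) x :=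
  roundS3.preservedAt_orbitMk (contMDiff_smul_subgroup Γ₀)
    (fun γ x => preservedAt_smul_roundS3 γ.1.2 x) x

end SpaceFormGeometry

/-! ### The covering of a suspension by a cylinder -/

section SuspensionGeometry

variable {Γ₀ : Subgroup SO4} [Finite Γ₀] [IsCancelSMul Γ₀ S3]

/-- Every element of the group `⟨(l, ψ)⟩` acts as a product of a translation and an isometry. -/
theorem suspensionGroup_smul_eq (l : Set.Ioi (0 : ℝ)) (ψ : SpaceForm.Iso Γ₀)
    (g : suspensionGroup Γ₀ l ψ) : ∃ k : ℤ, (fun x : ℝ × SpaceForm Γ₀ => g • x) =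
      Prod.map (· + k * (l : ℝ)) (ψ ^ k).1 := by
  obtain ⟨_, k, rfl⟩ := g
  exact ⟨k, funext fun x => suspensionGenerator_zpow l ψ k x⟩

theorem contMDiff_smul_suspension (l : Set.Ioi (0 : ℝ)) (ψ : SpaceForm.Iso Γ₀)
    (g : suspensionGroup Γ₀ l ψ) :
    ContMDiff J4 J4 ∞ fun x : ℝ × SpaceForm Γ₀ => g • x := by
  obtain ⟨k, hk⟩ := suspensionGroup_smul_eq l ψ g
  rw [hk]
  have h : ContMDiff 𝓘(ℝ, ℝ) 𝓘(ℝ, ℝ) ∞ (fun t : ℝ => t + k * (l : ℝ)) :=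
    (contDiff_id.add contDiff_const).contMDiff
  exact h.prodMap (ψ ^ k).2.1

theorem preservedAt_smul_suspension (l : Set.Ioi (0 : ℝ)) (ψ : SpaceForm.Iso Γ₀)
    (g : suspensionGroup Γ₀ l ψ) (x : ℝ × SpaceForm Γ₀) :
    TimedFourManifold.PreservedAt (cylinderManifold (spaceFormMetric Γ₀))
      (cylinderManifold (spaceFormMetric Γ₀)) (fun x : ℝ × SpaceForm Γ₀ => g • x) x := by
  obtain ⟨k, hk⟩ := suspensionGroup_smul_eq l ψ g
  rw [hk]
  exact preservedAt_cylinderManifold _ ((ψ ^ k).2.2.2 x.2)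
    ((ψ ^ k).2.1.mdifferentiable (by simp) _)

/-- The projection `ℝ × Σ → (ℝ × Σ) / ⟨(l, ψ)⟩`. -/
def suspensionProj (l : Set.Ioi (0 : ℝ)) (ψ : SpaceForm.Iso Γ₀) :
    (cylinderManifold (spaceFormMetric Γ₀)).carrier → (suspension Γ₀ l ψ).carrier :=
  Quotient.mk (MulAction.orbitRel (suspensionGroup Γ₀ l ψ) (ℝ × SpaceForm Γ₀))

variable (l : Set.Ioi (0 : ℝ)) (ψ : SpaceForm.Iso Γ₀)

theorem suspensionProj_surjective : Function.Surjective (suspensionProj l ψ) :=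
  Quotient.mk_surjective

variable {l ψ} in
theorem suspensionProj_eq_iff {x y : ℝ × SpaceForm Γ₀} :
    suspensionProj l ψ x = suspensionProj l ψ y ↔
      ∃ k : ℤ, x = (y.1 + k * (l : ℝ), (ψ ^ k).1 y.2) := by
  refine Quotient.eq.trans ?_
  constructor
  · rintro ⟨g, rfl⟩
    obtain ⟨k, hk⟩ := suspensionGroup_smul_eq l ψ g
    exact ⟨k, congrFun hk y⟩
  · rintro ⟨k, rfl⟩
    exact ⟨⟨_, k, rfl⟩, suspensionGenerator_zpow l ψ k y⟩

instance instIsManifoldCylinder : IsManifold J4 ∞ (ℝ × SpaceForm Γ₀) :=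
  IsManifold.prod (I := 𝓘(ℝ, ℝ)) (I' := 𝓡 3) ℝ (SpaceForm Γ₀)

theorem isManifold_suspension : IsManifold J4 ∞ (suspension Γ₀ l ψ).carrier := by
  have h := isManifold_orbitRel_quotient (contMDiff_smul_suspension l ψ)
  exact h

theorem isLocalDiffeomorph_suspensionProj :
    IsLocalDiffeomorph J4 J4 ∞ (suspensionProj l ψ) := by
  have h := isLocalDiffeomorph_orbitMk (contMDiff_smul_suspension l ψ)
  exact h

/-- The projection `ℝ × Σ → (ℝ × Σ) / ⟨(l, ψ)⟩` preserves the metric, the orientation and the time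
field; for the time field this uses that `∂/∂t` is invariant under the group. -/
theorem preservedAt_suspensionProj (x : ℝ × SpaceForm Γ₀) :
    TimedFourManifold.PreservedAt (cylinderManifold (spaceFormMetric Γ₀)) (suspension Γ₀ l ψ)
      (suspensionProj l ψ) x := by
  refine ⟨OrientedMetric.preservedAt_orbitMk (X := ℝ × SpaceForm Γ₀) _
    (contMDiff_smul_suspension l ψ)
    (fun g x => (preservedAt_smul_suspension l ψ g x).1) x, ?_⟩
  obtain ⟨g, hg⟩ : ∃ g : suspensionGroup Γ₀ l ψ, g • x = Quotient.out (Quotient.mk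
      (MulAction.orbitRel (suspensionGroup Γ₀ l ψ) (ℝ × SpaceForm Γ₀)) x) :=
    Quotient.exact (s := MulAction.orbitRel (suspensionGroup Γ₀ l ψ) (ℝ × SpaceForm Γ₀))
      (Quotient.out_eq _)
  have h1 := mfderiv_orbitMk_smul (X := ℝ × SpaceForm Γ₀) (contMDiff_smul_suspension l ψ) g x
    (cylinderTime x)
  have h2 : mfderiv J4 J4 (fun x : ℝ × SpaceForm Γ₀ => g • x) x (cylinderTime x) =
    cylinderTime (g • x) := (preservedAt_smul_suspension l ψ g x).2
  rw [h2] at h1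
  refine h1.symm.trans ?_
  change _ = quotientProjDeriv J4 (Quotient.mk (MulAction.orbitRel (suspensionGroup Γ₀ l ψ)
    (ℝ × SpaceForm Γ₀)) x) (cylinderTime _)
  unfold quotientProjDeriv
  rw [← hg]
  rfl

theorem isTypeS1S3_suspension : (suspension Γ₀ l ψ).IsTypeS1S3 where
  t2 := inferInstanceAs (T2Space (Quotient (MulAction.orbitRel (suspensionGroup Γ₀ l ψ)
    (ℝ × SpaceForm Γ₀))))
  secondCountable := ContinuousConstSMul.secondCountableTopology
    (Γ := suspensionGroup Γ₀ l ψ) (T := ℝ × SpaceForm Γ₀)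
  connected := inferInstanceAs (ConnectedSpace (Quotient
    (MulAction.orbitRel (suspensionGroup Γ₀ l ψ) (ℝ × SpaceForm Γ₀))))
  smooth := isManifold_suspension l ψ
  locallyModelled := by
    intro q
    obtain ⟨⟨t, s⟩, rfl⟩ := suspensionProj_surjective l ψ q
    obtain ⟨s, rfl⟩ := Quotient.mk_surjective (s := MulAction.orbitRel Γ₀ S3) s
    -- The composite `ℝ × S³ → ℝ × Σ → (ℝ × Σ) / ⟨(l, ψ)⟩`.
    let P : (cylinderManifold roundS3).carrier → (cylinderManifold (spaceFormMetric Γ₀)).carrier :=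
      Prod.map (· + (0 : ℝ)) (spaceFormProj Γ₀)
    have hP : IsLocalDiffeomorph J4 J4 ∞ P := fun x => by
      have h0 : IsLocalDiffeomorphAt 𝓘(ℝ, ℝ) 𝓘(ℝ, ℝ) ∞ (· + (0 : ℝ)) x.1 := by
        rw [show (· + (0 : ℝ)) = id from funext add_zero]
        exact (Diffeomorph.refl 𝓘(ℝ, ℝ) ℝ ∞).isLocalDiffeomorph x.1
      exact h0.prodMap (isLocalDiffeomorph_spaceFormProj Γ₀ x.2)
    have hQ : IsLocalDiffeomorph J4 J4 ∞ (suspensionProj l ψ ∘ P) := fun x =>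
      (hP x).comp (hg := isLocalDiffeomorph_suspensionProj l ψ (P x))
    have hQp : ∀ x, TimedFourManifold.PreservedAt (cylinderManifold roundS3) (suspension Γ₀ l ψ)
        (suspensionProj l ψ ∘ P) x := fun x =>
      (preservedAt_suspensionProj l ψ (P x)).comp
        (preservedAt_cylinderManifold 0 (preservedAt_spaceFormProj Γ₀ x.2)
          ((isLocalDiffeomorph_spaceFormProj Γ₀).mdifferentiable (by simp) _))
        ((isLocalDiffeomorph_suspensionProj l ψ).mdifferentiable (by simp) _)
        (hP.mdifferentiable (by simp) _)
    have hx : (suspensionProj l ψ ∘ P) ((t, s) : ℝ × S3) =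
        suspensionProj l ψ (t, Quotient.mk (MulAction.orbitRel Γ₀ S3) s) :=
      congrArg (suspensionProj l ψ) (Prod.ext (add_zero t) rfl)
    rw [← hx]
    set Q := suspensionProj l ψ ∘ P
    have hloc := hQ ((t, s) : ℝ × S3)
    refine ⟨hloc.localInverse, hloc.localInverse_mem_source, fun y hy => ?_⟩
    -- The inverse of a map that preserves all tensors preserves them as well.
    refine TimedFourManifold.PreservedAt.of_comp_left (G := Q) ?_ (hQp _)
      (hQ.mdifferentiable (by simp) _) (hloc.localInverse.mdifferentiableAt (by simp) hy)
      (hQ _).mfderiv_bijective.injective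
    have hid : TimedFourManifold.PreservedAt (suspension Γ₀ l ψ) (suspension Γ₀ l ψ) id y :=
      ⟨OrientedMetric.preservedAt_id _ y, by rw [mfderiv_id]; rfl⟩
    exact hid.congr (Filter.eventuallyEq_of_mem
      (hloc.localInverse.open_source.mem_nhds hy) hloc.localInverse_eqOn_right)

end SuspensionGeometry

/-! ### Conjugate isometries have isomorphic suspensions -/

section Descent

variable {Γ₀ : Subgroup SO4} [Finite Γ₀] [IsCancelSMul Γ₀ S3]

/-- A map out of a suspension is smooth as soon as its pullback to `ℝ × Σ` is. -/
theorem contMDiff_of_comp_suspensionProj {l : Set.Ioi (0 : ℝ)} {ψ : SpaceForm.Iso Γ₀}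
    {M : TimedFourManifold} {f : (suspension Γ₀ l ψ).carrier → M.carrier}
    (h : ContMDiff J4 J4 ∞ (f ∘ suspensionProj l ψ)) : ContMDiff J4 J4 ∞ f := by
  intro q
  obtain ⟨x, rfl⟩ := suspensionProj_surjective l ψ q
  have hloc := isLocalDiffeomorph_suspensionProj l ψ x
  have h1 : ContMDiffAt J4 J4 ∞ ((f ∘ suspensionProj l ψ) ∘ hloc.localInverse)
      (suspensionProj l ψ x) := (h _).comp _ hloc.localInverse_contMDiffAt
  refine h1.congr_of_eventuallyEq ?_
  filter_upwards [hloc.localInverse_eventuallyEq_right] with q hq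
  exact (congrArg f hq).symm

/-- An isometry `η` of `Σ` that intertwines `ψ` and `ψ'` descends to a map of suspensions that
preserves all tensors. -/
theorem exists_suspension_map (l : Set.Ioi (0 : ℝ)) {ψ ψ' η : SpaceForm.Iso Γ₀}
    (h : SemiconjBy η ψ ψ') :
    ∃ D : (suspension Γ₀ l ψ).carrier → (suspension Γ₀ l ψ').carrier,
      ContMDiff J4 J4 ∞ D ∧ (∀ q, TimedFourManifold.PreservedAt _ _ D q) ∧
      ∀ t s, D (suspensionProj l ψ (t, s)) = suspensionProj l ψ' (t, η.1 s) := by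
  let K : (cylinderManifold (spaceFormMetric Γ₀)).carrier →
      (cylinderManifold (spaceFormMetric Γ₀)).carrier := Prod.map (· + (0 : ℝ)) η.1
  have hKd : ContMDiff J4 J4 ∞ K := by
    have h0 : ContMDiff 𝓘(ℝ, ℝ) 𝓘(ℝ, ℝ) ∞ (· + (0 : ℝ)) :=
      (contDiff_id.add contDiff_const).contMDiff
    exact h0.prodMap η.2.1
  have hKp : ∀ x, TimedFourManifold.PreservedAt _ _ K x := fun x =>
    preservedAt_cylinderManifold 0 (η.2.2.2 x.2) (η.2.1.mdifferentiable (by simp) _)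
  let D : (suspension Γ₀ l ψ).carrier → (suspension Γ₀ l ψ').carrier :=
    Quotient.lift (suspensionProj l ψ' ∘ K) <| by
      intro x y hxy
      obtain ⟨k, rfl⟩ := suspensionProj_eq_iff.1 (Quotient.sound hxy :
        suspensionProj l ψ x = suspensionProj l ψ y)
      refine suspensionProj_eq_iff.2 ⟨k, Prod.ext ?_ ?_⟩
      · change y.1 + k * (l : ℝ) + 0 = y.1 + 0 + k * (l : ℝ)
        ring
      · exact congrArg (fun f : SpaceForm.Iso Γ₀ => f.1 y.2) (h.zpow_right k).eq
  have hD : D ∘ suspensionProj l ψ = suspensionProj l ψ' ∘ K := rfl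
  have hDs : ContMDiff J4 J4 ∞ D := by
    refine contMDiff_of_comp_suspensionProj ?_
    rw [hD]
    exact (isLocalDiffeomorph_suspensionProj l ψ').contMDiff.comp hKd
  refine ⟨D, hDs, fun q => ?_, fun t s => ?_⟩
  · obtain ⟨x, rfl⟩ := suspensionProj_surjective l ψ q
    refine TimedFourManifold.PreservedAt.of_comp_right (F := suspensionProj l ψ) ?_
      (preservedAt_suspensionProj l ψ x) (hDs.mdifferentiable (by simp) _)
      ((isLocalDiffeomorph_suspensionProj l ψ).mdifferentiable (by simp) _)
      (isLocalDiffeomorph_suspensionProj l ψ x).mfderiv_bijective.surjective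
    rw [hD]
    exact (preservedAt_suspensionProj l ψ' (K x)).comp (hKp x)
      ((isLocalDiffeomorph_suspensionProj l ψ').mdifferentiable (by simp) _)
      (hKd.mdifferentiable (by simp) _)
  · exact congrArg (suspensionProj l ψ') (Prod.ext (add_zero t) rfl)

theorem suspension_isomorphic_of_isConj (l : Set.Ioi (0 : ℝ)) {ψ ψ' : SpaceForm.Iso Γ₀}
    (h : IsConj ψ ψ') : (suspension Γ₀ l ψ).Isomorphic (suspension Γ₀ l ψ') := by
  obtain ⟨η, hη⟩ := h
  obtain ⟨D, hDs, hDp, hD⟩ := exists_suspension_map l hη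
  obtain ⟨D', hDs', -, hD'⟩ := exists_suspension_map l (SemiconjBy.inv_symm_left hη)
  refine ⟨⟨⟨D, D', fun q => ?_, fun q => ?_⟩, hDs, hDs'⟩, hDp⟩
  · obtain ⟨⟨t, s⟩, rfl⟩ := suspensionProj_surjective l ψ q
    rw [hD, hD']
    exact congrArg (fun f : SpaceForm.Iso Γ₀ => suspensionProj l ψ (t, f.1 s))
      (inv_mul_cancel η.1)
  · obtain ⟨⟨t, s⟩, rfl⟩ := suspensionProj_surjective l ψ' q
    rw [hD', hD]
    exact congrArg (fun f : SpaceForm.Iso Γ₀ => suspensionProj l ψ' (t, f.1 s))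
      (mul_inv_cancel η.1)

end Descent

/-! ### Lifting isomorphisms of suspensions to cylinders -/

section Lifting

variable {N N' : Type} [TopologicalSpace N] [ChartedSpace (EuclideanSpace ℝ (Fin 3)) N]
  [TopologicalSpace N'] [ChartedSpace (EuclideanSpace ℝ (Fin 3)) N']

theorem TimedFourManifold.PreservedAt.mfderiv_time {h : OrientedMetric 3 (𝓡 3) N}
    {h' : OrientedMetric 3 (𝓡 3) N'} {L : ℝ × N → ℝ × N'} {x : ℝ × N}
    (hL : TimedFourManifold.PreservedAt (cylinderManifold h) (cylinderManifold h') L x) :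
    mfderiv J4 J4 L x ((1, 0) : E31) = ((1, 0) : E31) := by
  have h1 : mfderiv J4 J4 L x (cylinderTime x) = cylinderTime (L x) := hL.2
  rw [cylinderTime_eq] at h1
  exact h1.trans (cylinderTime_eq _)

/-- Since `dt` is the metric dual of `∂/∂t`, a map of cylinders that preserves the metric and
`∂/∂t` preserves `dt`. -/
theorem TimedFourManifold.PreservedAt.fst_mfderiv {h : OrientedMetric 3 (𝓡 3) N}
    {h' : OrientedMetric 3 (𝓡 3) N'} {L : ℝ × N → ℝ × N'} {x : ℝ × N}
    (hL : TimedFourManifold.PreservedAt (cylinderManifold h) (cylinderManifold h') L x)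
    (v : E31) : Prod.fst (mfderiv J4 J4 L x v : E31) = v.1 := by
  have h1 : h'.cylinder.metric (L x) (mfderiv J4 J4 L x ((1, 0) : E31)) (mfderiv J4 J4 L x v) =
    h.cylinder.metric x ((1, 0) : E31) v := hL.1.1 _ _
  rw [hL.mfderiv_time] at h1
  replace h1 := ((OrientedMetric.cylinder_metric_apply h' _ _ _).symm.trans h1).trans
    (OrientedMetric.cylinder_metric_apply h _ _ _)
  have z : h.metric x.2 (0 : EuclideanSpace ℝ (Fin 3)) v.2 = 0 :=
    congrArg (fun B => B v.2) (map_zero (h.metric x.2))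
  let w : E31 := mfderiv J4 J4 L x v
  have z' : h'.metric (L x).2 (0 : EuclideanSpace ℝ (Fin 3)) w.2 = 0 :=
    congrArg (fun B => B w.2) (map_zero (h'.metric (L x).2))
  have h2 : 1 * w.1 + h'.metric (L x).2 (0 : EuclideanSpace ℝ (Fin 3)) w.2 =
    1 * v.1 + h.metric x.2 (0 : EuclideanSpace ℝ (Fin 3)) v.2 := h1
  rwa [z, z', one_mul, one_mul, add_zero, add_zero] at h2

variable {Γ₀ : Subgroup SO4} [Finite Γ₀] [IsCancelSMul Γ₀ S3]

/-- The deck group acts on the `ℝ`-coordinate by nontrivial translations, so the projection is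
injective on each slice `{t} × Σ`. -/
theorem suspensionProj_injective_of_fst_eq {l : Set.Ioi (0 : ℝ)} {ψ : SpaceForm.Iso Γ₀} {t : ℝ}
    {s s' : SpaceForm Γ₀} (h : suspensionProj l ψ (t, s) = suspensionProj l ψ (t, s')) :
    s = s' := by
  obtain ⟨k, hk⟩ := suspensionProj_eq_iff.1 h
  have h1 : t = t + k * (l : ℝ) := congrArg Prod.fst hk
  have h2 : s = (ψ ^ k).1 s' := congrArg Prod.snd hk
  have h3 : (k : ℝ) = 0 := (mul_eq_zero.1 (by linarith)).resolve_right (ne_of_gt l.2)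
  obtain rfl : k = 0 := by exact_mod_cast h3
  simpa using h2

variable {l l' : Set.Ioi (0 : ℝ)} {ψ ψ' : SpaceForm.Iso Γ₀}
  {G : ℝ × SpaceForm Γ₀ → (suspension Γ₀ l' ψ').carrier}

/-- A map from `ℝ × Σ` to a suspension that preserves all tensors lifts locally to `ℝ × Σ`, and
the lift translates the `ℝ`-coordinate because it preserves `dt`. -/
theorem exists_local_lift (hG : ContMDiff J4 J4 ∞ G)
    (hGp : ∀ x, TimedFourManifold.PreservedAt (cylinderManifold (spaceFormMetric Γ₀))
      (suspension Γ₀ l' ψ') G x)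
    {x y : ℝ × SpaceForm Γ₀} (hxy : suspensionProj l' ψ' y = G x) :
    ∃ L : ℝ × SpaceForm Γ₀ → ℝ × SpaceForm Γ₀, L x = y ∧
      ∀ᶠ z in 𝓝 x, suspensionProj l' ψ' (L z) = G z ∧ ContMDiffAt J4 J4 ∞ L z ∧
        TimedFourManifold.PreservedAt (cylinderManifold (spaceFormMetric Γ₀))
          (cylinderManifold (spaceFormMetric Γ₀)) L z ∧ (L z).1 = z.1 + (y.1 - x.1) := by
  have hloc := isLocalDiffeomorph_suspensionProj l' ψ' y
  have hP := isLocalDiffeomorph_suspensionProj l' ψ'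
  set σ := hloc.localInverse with hσ
  have hmem : G x ∈ σ.source := hxy ▸ hloc.localInverse_mem_source
  let L : ℝ × SpaceForm Γ₀ → ℝ × SpaceForm Γ₀ := σ ∘ G
  have hLx : L x = y := by
    change σ (G x) = y
    rw [← hxy]
    exact hloc.localInverse_left_inv hloc.localInverse_mem_target
  have hsrc : ∀ᶠ z in 𝓝 x, G z ∈ σ.source :=
    hG.continuous.continuousAt.eventually (σ.open_source.mem_nhds hmem)
  have hπ : ∀ᶠ z in 𝓝 x, suspensionProj l' ψ' (L z) = G z := by
    filter_upwards [hsrc] with z hz using hloc.localInverse_right_inv hz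
  have hd : ∀ᶠ z in 𝓝 x, ContMDiffAt J4 J4 ∞ L z := by
    filter_upwards [hsrc] with z hz
    exact (σ.contMDiffOn.contMDiffAt (σ.open_source.mem_nhds hz)).comp z (hG z)
  have hp : ∀ᶠ z in 𝓝 x, TimedFourManifold.PreservedAt (cylinderManifold (spaceFormMetric Γ₀))
      (cylinderManifold (spaceFormMetric Γ₀)) L z := by
    filter_upwards [hπ.eventually_nhds, hd] with z hz hzd
    exact TimedFourManifold.PreservedAt.of_comp_left (G := suspensionProj l' ψ')
      ((hGp z).congr hz) (preservedAt_suspensionProj l' ψ' _)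
      (hP.mdifferentiable (by simp) _) (hzd.mdifferentiableAt (by simp))
      (hP _).mfderiv_bijective.injective
  have hc : ∀ᶠ z in 𝓝 x, (L z).1 - z.1 = (L x).1 - x.1 := by
    have key : ∀ᶠ z in 𝓝 x, HasMFDerivAt J4 𝓘(ℝ, ℝ) (fun z => (L z).1 - z.1) z
        (0 : TangentSpace J4 z →L[ℝ] ℝ) := by
      filter_upwards [hd, hp] with z hz hzp
      have e1 := (hasMFDerivAt_fst (I := 𝓘(ℝ, ℝ)) (I' := 𝓡 3) (L z)).comp z
        (hz.mdifferentiableAt (by simp)).hasMFDerivAt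
      have e2 := e1.sub (hasMFDerivAt_fst (I := 𝓘(ℝ, ℝ)) (I' := 𝓡 3) z)
      refine e2.congr_mfderiv ?_
      ext v
      exact sub_eq_zero.2 (hzp.fst_mfderiv v)
    have : IsManifold J4 1 (ℝ × SpaceForm Γ₀) := .of_le (n := ∞) (by simp)
    exact eventually_eq_of_mfderiv_eq_zero (I := J4) (I' := 𝓘(ℝ, ℝ))
      (key.mono fun z hz => hz.mdifferentiableAt) (key.mono fun z hz => hz.mfderiv)
  refine ⟨L, hLx, ?_⟩
  filter_upwards [hπ, hd, hp, hc] with z h1 h2 h3 h4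
  refine ⟨h1, h2, h3, ?_⟩
  rw [hLx] at h4
  linarith

/-- The points of `ℝ × Σ` over `G x` have a `t`-coordinate which is determined modulo `l'`, and
modulo `l'` it differs from that of `x` by a constant: the set where the difference has a given
class is open, and `ℝ × Σ` is connected. -/
theorem exists_lift_fst_eq_add (hG : ContMDiff J4 J4 ∞ G)
    (hGp : ∀ x, TimedFourManifold.PreservedAt (cylinderManifold (spaceFormMetric Γ₀))
      (suspension Γ₀ l' ψ') G x)
    {x₀ y₀ : ℝ × SpaceForm Γ₀} (h₀ : suspensionProj l' ψ' y₀ = G x₀) (x : ℝ × SpaceForm Γ₀) :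
    ∃ s, suspensionProj l' ψ' (x.1 + (y₀.1 - x₀.1), s) = G x := by
  let A : ℝ → Set (ℝ × SpaceForm Γ₀) := fun c => {x | ∃ s, suspensionProj l' ψ' (x.1 + c, s) = G x}
  have hA : ∀ x y, suspensionProj l' ψ' y = G x → x ∈ A (y.1 - x.1) := fun x y h =>
    ⟨y.2, by rw [add_sub_cancel]; exact h⟩
  have hopen : ∀ c, IsOpen (A c) := by
    refine fun c => isOpen_iff_mem_nhds.2 ?_
    rintro x ⟨s, hs⟩
    obtain ⟨L, -, hL⟩ := exists_local_lift hG hGp hs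
    filter_upwards [hL] with z hz
    refine ⟨(L z).2, ?_⟩
    have h1 : (L z).1 = z.1 + c := by rw [hz.2.2.2]; simp
    rw [← h1]
    exact hz.1
  -- `A c` and `A c'` agree as soon as they meet, because then `c - c'` is a multiple of `l'`.
  have hsub : ∀ c c' x, x ∈ A c → x ∈ A c' → A c' ⊆ A c := by
    rintro c c' x ⟨s, hs⟩ ⟨s', hs'⟩ y ⟨u, hu⟩
    obtain ⟨k, hk⟩ := suspensionProj_eq_iff.1 (hs.trans hs'.symm)
    have h1 : x.1 + c = x.1 + c' + k * (l' : ℝ) := congrArg Prod.fst hk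
    refine ⟨(ψ' ^ k).1 u, ?_⟩
    rw [← hu]
    refine suspensionProj_eq_iff.2 ⟨k, Prod.ext ?_ rfl⟩
    change y.1 + c = y.1 + c' + k * (l' : ℝ)
    linarith
  -- The sets `A c` cover `ℝ × Σ`, so the complement of one is a union of others.
  have hclosed : IsClosed (A (y₀.1 - x₀.1)) := by
    refine ⟨isOpen_iff_mem_nhds.2 fun x hx => ?_⟩
    obtain ⟨y, hy⟩ := suspensionProj_surjective l' ψ' (G x)
    filter_upwards [(hopen _).mem_nhds (hA x y hy)] with z hz hz'
    exact hx (hsub _ _ z hz' hz (hA x y hy))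
  have huniv := IsClopen.eq_univ ⟨hclosed, hopen _⟩ ⟨x₀, hA x₀ y₀ h₀⟩
  have hx : x ∈ A (y₀.1 - x₀.1) := huniv ▸ Set.mem_univ x
  exact hx

/-- A map from `ℝ × Σ` to `(ℝ × Σ) / ⟨(l', ψ')⟩` that preserves all tensors lifts to a product of a
translation with an orientation-preserving local isometry of `Σ`. -/
theorem exists_lift (hG : ContMDiff J4 J4 ∞ G)
    (hGp : ∀ x, TimedFourManifold.PreservedAt (cylinderManifold (spaceFormMetric Γ₀))
      (suspension Γ₀ l' ψ') G x)
    {x₀ y₀ : ℝ × SpaceForm Γ₀} (h₀ : suspensionProj l' ψ' y₀ = G x₀) :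
    ∃ g : SpaceForm Γ₀ → SpaceForm Γ₀, ContMDiff (𝓡 3) (𝓡 3) ∞ g ∧
      (∀ s, (spaceFormMetric Γ₀).PreservedAt (spaceFormMetric Γ₀) g s) ∧
      ∀ t s, G (t, s) = suspensionProj l' ψ' (t + (y₀.1 - x₀.1), g s) := by
  set c := y₀.1 - x₀.1
  -- A point over `G x` is determined by its `t`-coordinate, so the chosen lift agrees with the
  -- local lifts and is smooth.
  choose g hg using exists_lift_fst_eq_add hG hGp h₀
  let K : ℝ × SpaceForm Γ₀ → ℝ × SpaceForm Γ₀ := fun x => (x.1 + c, g x)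
  have hloc : ∀ x, ∃ L : ℝ × SpaceForm Γ₀ → ℝ × SpaceForm Γ₀, K =ᶠ[𝓝 x] L ∧
      ContMDiffAt J4 J4 ∞ L x ∧
      TimedFourManifold.PreservedAt (cylinderManifold (spaceFormMetric Γ₀))
          (cylinderManifold (spaceFormMetric Γ₀)) L x := by
    intro x
    obtain ⟨L, -, hL⟩ := exists_local_lift hG hGp (hg x)
    refine ⟨L, ?_, hL.self_of_nhds.2.1, hL.self_of_nhds.2.2.1⟩
    filter_upwards [hL] with z hz
    have h1 : (L z).1 = z.1 + c := by rw [hz.2.2.2]; simp [c]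
    refine Prod.ext h1.symm
      (suspensionProj_injective_of_fst_eq (l := l') (ψ := ψ') (t := z.1 + c) ?_)
    rw [hg z, ← hz.1, ← h1]
  have hKd : ContMDiff J4 J4 ∞ K := fun x => by
    obtain ⟨L, h1, h2, -⟩ := hloc x
    exact h2.congr_of_eventuallyEq h1
  have hKp : ∀ x, TimedFourManifold.PreservedAt (cylinderManifold (spaceFormMetric Γ₀))
      (cylinderManifold (spaceFormMetric Γ₀)) K x := fun x => by
    obtain ⟨L, h1, -, h3⟩ := hloc x
    exact h3.congr h1
  have hgd : ContMDiff J4 (𝓡 3) ∞ g := contMDiff_snd.comp hKd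
  -- The second component of the lift is constant along the flow lines of `∂/∂t`.
  have hgt : ∀ t s, g (t, s) = g (0, s) := by
    intro t s
    have hi : ∀ t : ℝ, HasMFDerivAt 𝓘(ℝ, ℝ) J4 (fun t : ℝ => ((t, s) : ℝ × SpaceForm Γ₀)) t
        (ContinuousLinearMap.inl ℝ ℝ (EuclideanSpace ℝ (Fin 3))) := fun t =>
      (mdifferentiableAt_id.prodMk mdifferentiableAt_const).hasMFDerivAt.congr_mfderiv
        mfderiv_prod_left
    have hd : ∀ t : ℝ, HasMFDerivAt 𝓘(ℝ, ℝ) (𝓡 3) (fun t : ℝ => g (t, s)) t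
        (0 : ℝ →L[ℝ] EuclideanSpace ℝ (Fin 3)) := by
      intro t
      have e1 := (hKd.mdifferentiable (by simp) (t, s)).hasMFDerivAt.comp t (hi t)
      have e2 := (hasMFDerivAt_snd (I := 𝓘(ℝ, ℝ)) (I' := 𝓡 3) (K (t, s))).comp t e1
      refine e2.congr_mfderiv ?_
      ext1
      exact congrArg Prod.snd (hKp (t, s)).mfderiv_time
    have : IsManifold (𝓡 3) 1 (SpaceForm Γ₀) := .of_le (n := ∞) (by simp)
    exact eq_of_mfderiv_eq_zero (I := 𝓘(ℝ, ℝ)) (I' := 𝓡 3) (f := fun t : ℝ => g (t, s))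
      (fun t => (hd t).mdifferentiableAt) (fun t => (hd t).mfderiv) t 0
  have hi : ContMDiff (𝓡 3) J4 ∞ fun s : SpaceForm Γ₀ => ((0, s) : ℝ × SpaceForm Γ₀) :=
    contMDiff_const.prodMk contMDiff_id
  have hg0 : ContMDiff (𝓡 3) (𝓡 3) ∞ fun s => g (0, s) := hgd.comp hi
  have hK : K = Prod.map (· + c) fun s => g (0, s) :=
    funext fun x => Prod.ext rfl (hgt x.1 x.2)
  refine ⟨fun s => g (0, s), hg0, fun s => ?_, fun t s => ?_⟩
  · have h1 := (hKp (0, s)).1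
    rw [hK] at h1
    exact OrientedMetric.PreservedAt.of_cylinder c h1 (hg0.mdifferentiable (by simp) s)
  · rw [← hg (t, s), hgt t s]

end Lifting

/-! ### Isomorphic suspensions come from the same data -/

section Injectivity

variable {Γ₀ : Subgroup SO4} [Finite Γ₀] [IsCancelSMul Γ₀ S3]

/-- An isomorphism of suspensions is induced by a translation of `ℝ` and an isometry of `Σ`. -/
theorem exists_iso_of_isomorphic {l l' : Set.Ioi (0 : ℝ)} {ψ ψ' : SpaceForm.Iso Γ₀}
    (h : (suspension Γ₀ l ψ).Isomorphic (suspension Γ₀ l' ψ')) :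
    ∃ (F : (suspension Γ₀ l ψ).carrier ≃ (suspension Γ₀ l' ψ').carrier) (c : ℝ)
      (η : SpaceForm.Iso Γ₀), ∀ t s,
      F (suspensionProj l ψ (t, s)) = suspensionProj l' ψ' (t + c, η.1 s) := by
  obtain ⟨F, hF⟩ := h
  have hF' : ∀ q, TimedFourManifold.PreservedAt _ _ F.symm q := by
    intro q
    obtain ⟨p, rfl⟩ := F.surjective q
    refine TimedFourManifold.PreservedAt.of_comp_right (F := F) ?_ (hF p)
      (F.symm.contMDiff.mdifferentiable (by simp) _) (F.contMDiff.mdifferentiable (by simp) _)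
      (F.isLocalDiffeomorph p).mfderiv_bijective.surjective
    rw [show F.symm ∘ F = id from funext F.symm_apply_apply]
    exact ⟨OrientedMetric.preservedAt_id _ p, by rw [mfderiv_id]; rfl⟩
  have hG : ∀ (l l' : Set.Ioi (0 : ℝ)) (ψ ψ' : SpaceForm.Iso Γ₀)
      (F : (suspension Γ₀ l ψ).carrier ≃ₘ^∞⟮J4, J4⟯ (suspension Γ₀ l' ψ').carrier),
      (∀ x, TimedFourManifold.PreservedAt _ _ F x) →
      ContMDiff J4 J4 ∞ (F ∘ suspensionProj l ψ) ∧
      ∀ x, TimedFourManifold.PreservedAt (cylinderManifold (spaceFormMetric Γ₀))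
        (suspension Γ₀ l' ψ') (F ∘ suspensionProj l ψ) x := by
    intro l l' ψ ψ' F hF
    have hP := isLocalDiffeomorph_suspensionProj l ψ
    exact ⟨F.contMDiff.comp hP.contMDiff, fun x =>
      (hF _).comp (preservedAt_suspensionProj l ψ x) (F.contMDiff.mdifferentiable (by simp) _)
        (hP.mdifferentiable (by simp) _)⟩
  obtain ⟨G1, G2⟩ := hG l l' ψ ψ' F hF
  obtain ⟨G1', G2'⟩ := hG l' l ψ' ψ F.symm hF'
  obtain ⟨s₀⟩ := (inferInstance : Nonempty (SpaceForm Γ₀))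
  -- Lift `F` and its inverse through corresponding base points, so that the translations cancel.
  obtain ⟨y₀, hy₀⟩ := suspensionProj_surjective l' ψ' (F (suspensionProj l ψ ((0 : ℝ), s₀)))
  obtain ⟨g, hg1, hg2, hg3⟩ := exists_lift G1 G2 hy₀
  obtain ⟨f, hf1, hf2, hf3⟩ := exists_lift (x₀ := y₀) (y₀ := ((0 : ℝ), s₀)) G1' G2'
    ((F.symm_apply_apply _).symm.trans (congrArg F.symm hy₀.symm))
  simp only [sub_zero, zero_sub] at hg3 hf3
  replace hg3 : ∀ t s, F (suspensionProj l ψ (t, s)) =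
    suspensionProj l' ψ' (t + y₀.1, g s) := hg3
  replace hf3 : ∀ t s, F.symm (suspensionProj l' ψ' (t, s)) =
    suspensionProj l ψ (t + -y₀.1, f s) := hf3
  have hfg : ∀ s, f (g s) = s := by
    intro s
    have h1 := hf3 (0 + y₀.1) (g s)
    rw [← hg3, F.symm_apply_apply, add_neg_cancel_right] at h1
    exact (suspensionProj_injective_of_fst_eq h1).symm
  have hgf : ∀ s, g (f s) = s := by
    intro s
    have h1 := hg3 (0 + -y₀.1) (f s)
    rw [← hf3, F.apply_symm_apply, neg_add_cancel_right] at h1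
    exact (suspensionProj_injective_of_fst_eq h1).symm
  exact ⟨F.toEquiv, y₀.1, ⟨⟨g, f, hfg, hgf⟩, hg1, hf1, hg2⟩, hg3⟩

/-- The pair `(l, [ψ])` is an invariant of the suspension: conjugation by the lift of an isomorphism
takes one deck group to the other, and it takes a generator to a generator because `l, l' > 0`. -/
theorem eq_and_isConj_of_isomorphic {l l' : Set.Ioi (0 : ℝ)} {ψ ψ' : SpaceForm.Iso Γ₀}
    (h : (suspension Γ₀ l ψ).Isomorphic (suspension Γ₀ l' ψ')) : l = l' ∧ IsConj ψ ψ' := by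
  obtain ⟨F, c, η, hF⟩ := exists_iso_of_isomorphic h
  have hl : (0 : ℝ) < l := l.2
  have hl' : (0 : ℝ) < l' := l'.2
  -- Apply `F` to `π (l, ψ s) = π (0, s)`: the generator of the first group
  -- becomes a power of the generator of the second one.
  have h1 : ∀ s, ∃ k : ℤ, (l : ℝ) = k * (l' : ℝ) ∧ η.1 (ψ.1 s) = (ψ' ^ k).1 (η.1 s) := by
    intro s
    have e : suspensionProj l ψ ((l : ℝ), ψ.1 s) = suspensionProj l ψ ((0 : ℝ), s) :=
      suspensionProj_eq_iff.2 ⟨1, by simp⟩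
    have e' := congrArg F e
    rw [hF, hF] at e'
    obtain ⟨k, hk⟩ := suspensionProj_eq_iff.1 e'
    refine ⟨k, ?_, congrArg Prod.snd hk⟩
    have : (l : ℝ) + c = 0 + c + k * (l' : ℝ) := congrArg Prod.fst hk
    linarith
  -- The same argument for the inverse of `F` shows that `l'` is a multiple of `l`.
  have h2 : ∃ m : ℤ, (l' : ℝ) = m * (l : ℝ) := by
    obtain ⟨s⟩ := (inferInstance : Nonempty (SpaceForm Γ₀))
    have e : suspensionProj l' ψ' ((l' : ℝ) + c, ψ'.1 (η.1 s)) =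
        suspensionProj l' ψ' (0 + c, η.1 s) :=
      suspensionProj_eq_iff.2 ⟨1, Prod.ext (by simp [add_comm]) (by simp)⟩
    have hη : ψ'.1 (η.1 s) = η.1 (η.1.symm (ψ'.1 (η.1 s))) := (η.1.apply_symm_apply _).symm
    rw [hη, ← hF, ← hF] at e
    obtain ⟨m, hm⟩ := suspensionProj_eq_iff.1 (F.injective e)
    refine ⟨m, ?_⟩
    have : (l' : ℝ) = 0 + m * (l : ℝ) := congrArg Prod.fst hm
    linarith
  have hk1 : ∀ k : ℤ, (l : ℝ) = k * (l' : ℝ) → k = 1 := by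
    intro k hk
    obtain ⟨m, hm⟩ := h2
    have hk0 : (0 : ℝ) < k := pos_of_mul_pos_left (hk ▸ hl) hl'.le
    have hkm : (k : ℝ) * m = 1 := by
      have : ((k : ℝ) * m) * l' = 1 * l' := by
        rw [one_mul, mul_right_comm, ← hk, mul_comm, ← hm]
      exact mul_right_cancel₀ hl'.ne' this
    have hk0' : 0 ≤ k := by exact_mod_cast hk0.le
    exact Int.eq_one_of_mul_eq_one_right hk0' (by exact_mod_cast hkm)
  refine ⟨?_, isConj_iff.2 ⟨η, ?_⟩⟩
  · obtain ⟨s⟩ := (inferInstance : Nonempty (SpaceForm Γ₀))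
    obtain ⟨k, hk, -⟩ := h1 s
    obtain rfl := hk1 k hk
    exact Subtype.ext (by simpa using hk)
  · rw [mul_inv_eq_iff_eq_mul]
    refine Subtype.ext (Equiv.ext fun s => ?_)
    obtain ⟨k, hk, hs⟩ := h1 s
    obtain rfl := hk1 k hk
    simpa using hs

end Injectivity

end

/-! ### The bijection onto the moduli set -/

theorem mainTheorem2 (Γ₀ : Subgroup SO4) [Finite Γ₀] [IsCancelSMul Γ₀ S3] :
    ∃ Φ : Set.Ioi (0 : ℝ) × ConjClasses (SpaceForm.Iso Γ₀) → ModuliSet Γ₀,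
      Function.Bijective Φ ∧
      ∀ (l : Set.Ioi (0 : ℝ)) (ψ : SpaceForm.Iso Γ₀),
        ∃ h : (suspension Γ₀ l ψ).IsTypeS1S3 ∧ (suspension Γ₀ l ψ).IsOfClass Γ₀,
          Φ (l, ConjClasses.mk ψ) =
            Quotient.mk (ManifoldOfClass.setoid Γ₀) ⟨suspension Γ₀ l ψ, h⟩ := by
  have hm : ∀ (l : Set.Ioi (0 : ℝ)) (ψ : SpaceForm.Iso Γ₀),
      (suspension Γ₀ l ψ).IsTypeS1S3 ∧ (suspension Γ₀ l ψ).IsOfClass Γ₀ :=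
    fun l ψ => ⟨isTypeS1S3_suspension l ψ, l, ψ, .refl _⟩
  let Φ : Set.Ioi (0 : ℝ) × ConjClasses (SpaceForm.Iso Γ₀) → ModuliSet Γ₀ := fun p =>
    Quotient.lift (s := IsConj.setoid (SpaceForm.Iso Γ₀)) (fun ψ => Quotient.mk
      (ManifoldOfClass.setoid Γ₀) ⟨suspension Γ₀ p.1 ψ, hm p.1 ψ⟩)
      (fun _ _ h => Quotient.sound (suspension_isomorphic_of_isConj p.1 h)) p.2
  refine ⟨Φ, ⟨?_, ?_⟩, fun l ψ => ⟨hm l ψ, rfl⟩⟩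
  · rintro ⟨l, ⟨ψ⟩⟩ ⟨l', ⟨ψ'⟩⟩ h
    obtain ⟨rfl, hc⟩ := eq_and_isConj_of_isomorphic (Quotient.exact h)
    exact Prod.ext rfl (Quotient.sound hc)
  · rintro ⟨⟨M, hM, l, ψ, h⟩⟩
    exact ⟨(l, ConjClasses.mk ψ), Quotient.sound h.symm⟩
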